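/- Fix $\Delta>0$, $\alpha_B,\alpha_E>0$, $\lambda_B,\lambda_E>0$ with $\alpha_B=\alpha_E$ and $\lambda_B/\alpha_B\le\lambda_E/\alpha_E$. In the discrete-time Poisson wiretap channel with slots of $\Delta$ seconds, an intensity $x\ge 0$ sent in a slot produces at the legitimate receiver a Poisson variable $Y$ with mean $(\alpha_Bx+\lambda_B)\Delta$ and at the eavesdropper a Poisson variable $Z$ with mean $(\alpha_Ex+\lambda_E)\Delta$; different slots are independent given the inputs. A code of block length $n$ with $M$ messages consists of a message $W$ uniform on $M$ values, a stochastic encoder sending $W$ to a random vector $X^n\in[0,\infty)^n$, and a decoder $g_n:\mathbb N^n\to\{1,\dots,M\}$ of the legitimate receiver; it satisfies the average-intensity constraint $\mathcal E$ if $\frac1n\sum_{i=1}^n\mathbb E[X_i]\le\mathcal E$ (there is no peak-intensity constraint). A rate $R\ge 0$ (in nats per second) is perfectly secure under the constraint $\mathcal E$ if there are codes of block length $n$ with $\lceil e^{n\Delta R}\rceil$ messages, $n\in\mathbb N$, satisfying the constraint, such that $\Pr[g_n(Y^n)\ne W]\to 0$ and $\frac1n I(W;Z^n)\to 0$ as $n\to\infty$.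 The secrecy capacity $C_S(\mathcal E)$ is the supremum of the perfectly secure rates. Then $$\lim_{\mathcal E\to 0^+}\frac{C_S(\mathcal E)}{\mathcal E}=\alpha_B\log\frac{\lambda_E}{\lambda_B},$$ where $\log$ is the natural logarithm (in particular $C_S(\mathcal E)$ is finite for all sufficiently small $\mathcal E>0$). -/

import Mathlib

open MeasureTheory ProbabilityTheory InformationTheory Filter Topology
open scoped NNReal ENNReal

namespace PoissonWiretap

noncomputable section

/-- A map into the probability measures on a countable discrete space is measurable as soon as the
masses of all points are measurable. -/
theorem measurable_of_singletons {α β : Type*} [MeasurableSpace α] [MeasurableSpace β]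
    [Countable β] [MeasurableSingletonClass β] (f : α → Measure β)
    (h : ∀ b, Measurable fun a => f a {b}) : Measurable f := by
  refine Measure.measurable_of_measurable_coe _ fun s _ => ?_
  simp_rw [← fun a => (f a).tsum_indicator_apply_singleton s (Set.to_countable s).measurableSet]
  refine Measurable.tsum fun b => ?_
  by_cases hb : b ∈ s
  · simpa [hb] using h b
  · simp [hb]

theorem measurable_poissonMeasure : Measurable poissonMeasure := by
  refine measurable_of_singletons _ fun k => ?_
  simp_rw [poissonMeasure_singleton]
  fun_prop

/-- One use of the photon-counting channel with gain `α`, dark current `lam` and slot duration `Δ`: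
given the intensity `x`, the output is Poisson with mean `(α * x + lam) * Δ`. -/
def channel (α lam Δ : ℝ≥0) : Kernel ℝ≥0 ℕ where
  toFun x := poissonMeasure ((α * x + lam) * Δ)
  measurable' := measurable_poissonMeasure.comp (by fun_prop)

instance (α lam Δ : ℝ≥0) : IsMarkovKernel (channel α lam Δ) :=
  ⟨fun x => inferInstanceAs (IsProbabilityMeasure (poissonMeasure ((α * x + lam) * Δ)))⟩

/-- `n` memoryless uses of the channel: given `x₁, …, xₙ`, the outputs are independent and the
`i`-th one has the law `channel α lam Δ xᵢ`. -/
def channelN (α lam Δ : ℝ≥0) (n : ℕ) : Kernel (Fin n → ℝ≥0) (Fin n → ℕ) where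
  toFun x := Measure.pi fun i => channel α lam Δ (x i)
  measurable' := by
    refine measurable_of_singletons _ fun k => ?_
    simp_rw [Measure.pi_singleton]
    exact Finset.measurable_prod _ fun i _ =>
      ((channel α lam Δ).measurable_coe (measurableSet_singleton _)).comp (measurable_pi_apply i)

instance (α lam Δ : ℝ≥0) (n : ℕ) : IsMarkovKernel (channelN α lam Δ n) :=
  ⟨fun x => inferInstanceAs (IsProbabilityMeasure (Measure.pi fun i => channel α lam Δ (x i)))⟩

/-- Mutual information, in nats, of two random variables with joint law `μ`. -/
def mutualInfo {β γ : Type*} [MeasurableSpace β] [MeasurableSpace γ]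
    (μ : Measure (β × γ)) : ℝ≥0∞ :=
  klDiv μ (μ.fst.prod μ.snd)

/-- A wiretap code of block length `n` for `M` messages: a stochastic encoder, which sends every
message to a random vector of `n` nonnegative intensities, and a decoder for the legitimate
receiver. -/
structure Code (n M : ℕ) where
  encoder : Kernel (Fin M) (Fin n → ℝ≥0)
  isMarkovKernel : IsMarkovKernel encoder
  decoder : (Fin n → ℕ) → Fin M

attribute [instance] Code.isMarkovKernel

namespace Code

variable {n M : ℕ}

/-- The law of the message: uniform on the `M` messages. -/
def messageLaw (M : ℕ) : Measure (Fin M) := uniformOn Set.univ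

/-- The law of the transmitted vector of intensities. -/
def inputLaw (c : Code n M) : Measure (Fin n → ℝ≥0) := (messageLaw M).bind c.encoder

/-- The joint law of the message and of the output vector of a channel with gain `α`, dark
current `lam` and slot duration `Δ`. -/
def jointLaw (c : Code n M) (α lam Δ : ℝ≥0) : Measure (Fin M × (Fin n → ℕ)) :=
  (messageLaw M) ⊗ₘ (channelN α lam Δ n ∘ₖ c.encoder)

/-- The average-intensity constraint `(1 / n) ∑ᵢ 𝔼[Xᵢ] ≤ E`. -/
def MeetsAverage (c : Code n M) (E : ℝ≥0) : Prop :=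
  ∑ i, ∫⁻ x, (x i : ℝ≥0∞) ∂c.inputLaw ≤ n * E

/-- The probability that the decoder, fed with the output of the channel, errs. -/
def errorProb (c : Code n M) (α lam Δ : ℝ≥0) : ℝ≥0∞ :=
  c.jointLaw α lam Δ {p | c.decoder p.2 ≠ p.1}

/-- The information, in nats, that the channel output gives about the message. -/
def leakage (c : Code n M) (α lam Δ : ℝ≥0) : ℝ≥0∞ :=
  mutualInfo (c.jointLaw α lam Δ)

end Code

/-- `R`, in nats per second, is a perfectly secure rate under the average-intensity constraint `E`:
there are codes, one for each block length `n`, with `⌈exp (n * Δ * R)⌉` messages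
(`n` slots last `n * Δ` seconds), whose error probability at the legitimate receiver (`αB`, `lamB`)
and whose leakage per slot to the eavesdropper (`αE`, `lamE`) tend to zero. -/
def IsSecureRate (αB lamB αE lamE Δ E R : ℝ≥0) : Prop :=
  ∃ c : ∀ n : ℕ, Code n ⌈Real.exp (n * Δ * R)⌉₊,
    (∀ n, (c n).MeetsAverage E) ∧
    Tendsto (fun n => (c n).errorProb αB lamB Δ) atTop (𝓝 0) ∧
    Tendsto (fun n => (c n).leakage αE lamE Δ / n) atTop (𝓝 0)

/-- The secrecy capacity, in nats per second, under the average-intensity constraint `E` (and no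
peak-intensity constraint): the supremum of the perfectly secure rates. -/
def secrecyCapacity (αB lamB αE lamE Δ E : ℝ≥0) : ℝ≥0∞ :=
  ⨆ (R : ℝ≥0) (_ : IsSecureRate αB lamB αE lamE Δ E R), (R : ℝ≥0∞)

end

end PoissonWiretap

/-! Measured from the dark output laws, an intensity `x` sent for one second costs the divergence
`(α x + l) log (1 + α x / l) - α x` at a receiver with dark current `l`. As the gains agree, the
legitimate receiver's divergence exceeds the eavesdropper's by `(α x + lB) log (1 + α x / lB) - (α x
+ lE) log (1 + α x / lE)`. This never exceeds `α x log (lE / lB)` (`gain_le`), and its ratio to `α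
x` tends to `log (lE / lB)` as `x` grows (`eventually_lt_gain`). Without a peak constraint, a small
average intensity can be spent on rare pulses of large intensity, so the linear bound is
asymptotically attained.

Converse. The eavesdropper's count has the law of the legitimate count plus an independent Poisson
dark count of mean `(lE - lB) Δ`. Let the legitimate receiver see both summands. For each input,
pair and sum have explicit densities `Θ` and `ψ` with respect to the output laws of the zero input.
An exponential moment bound (`lintegral_tilted_le`) replaces Fano's inequality and yields
`P(correct) log M ≤ log 2 + leakage + 𝔼 log (Θ / ψ)`. The last mean is controlled letter by letter
by `gain_le`; dividing by `n` gives `R ≤ α E log (lE / lB)` for every `E`.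

Achievability. Take `M * L` independent words with letters `A` (probability `p`) or `0`; the message
picks a row and the encoder picks an entry of it at random. Gallager's bound controls the error of
decoding both indices, and a Rényi bound for the information (`ofReal_mul_mutualInfo_add_one_le`)
controls the leakage by soft covering. Both bounds tensorize, and for small `p` their one-letter
exponents are governed by Chernoff sums of two Poisson laws (`chernoffPoisson`). Their derivatives
at `0` are minus the divergences above, so a small order `ρ` recovers the divergence difference. The
parameters are fixed in the order `A` large, `ρ` small, `p` proportional to `E`. -/

namespace PoissonWiretap

/-! ### Information density and a Rényi bound for mutual information -/

section Information

variable {α β : Type*} [MeasurableSpace α] [MeasurableSpace β]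

/-- The density of the joint law `μ ⊗ₘ κ` of input and output of a discrete channel with respect to
the product of its marginals. -/
noncomputable def infoDensity (μ : Measure α) (κ : Kernel α β) (p : α × β) : ℝ≥0∞ :=
  κ p.1 {p.2} / (κ ∘ₘ μ) {p.2}

theorem compProd_singleton_pair [MeasurableSingletonClass α] [MeasurableSingletonClass β]
    (μ : Measure α) [SFinite μ] (κ : Kernel α β) [IsSFiniteKernel κ]
    (a : α) (b : β) : (μ ⊗ₘ κ) {(a, b)} = μ {a} * κ a {b} := by
  rw [← Set.singleton_prod_singleton,
    Measure.compProd_apply_prod (measurableSet_singleton a) (measurableSet_singleton b)]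
  simp

theorem mutualInfo_compProd (μ : Measure α) [SFinite μ] (κ : Kernel α β) [IsMarkovKernel κ] :
    mutualInfo (μ ⊗ₘ κ) = klDiv (μ ⊗ₘ κ) (μ.prod (κ ∘ₘ μ)) := by
  rw [mutualInfo, Measure.fst_compProd, Measure.snd_compProd]

variable [Countable α] [Countable β] [MeasurableSingletonClass α] [MeasurableSingletonClass β]

variable (μ : Measure α) [IsProbabilityMeasure μ] (κ : Kernel α β) [IsMarkovKernel κ]

theorem compProd_eq_withDensity_infoDensity (h : ∀ b, (κ ∘ₘ μ) {b} ≠ 0) :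
    μ ⊗ₘ κ = (μ.prod (κ ∘ₘ μ)).withDensity (infoDensity μ κ) := by
  refine Measure.ext_of_singleton fun ⟨a, b⟩ => ?_
  rw [compProd_singleton_pair, withDensity_apply _ (measurableSet_singleton _),
    lintegral_singleton, ← Set.singleton_prod_singleton, Measure.prod_prod, infoDensity]
  rw [mul_left_comm, ENNReal.div_mul_cancel (h b) (measure_ne_top (κ ∘ₘ μ) {b})]

theorem rnDeriv_compProd_eq (h : ∀ b, (κ ∘ₘ μ) {b} ≠ 0) :
    (μ ⊗ₘ κ).rnDeriv (μ.prod (κ ∘ₘ μ)) =ᵐ[μ.prod (κ ∘ₘ μ)] infoDensity μ κ := by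
  rw [compProd_eq_withDensity_infoDensity μ κ h]
  exact Measure.rnDeriv_withDensity _ (.of_discrete)

theorem compProd_absolutelyContinuous_prod (h : ∀ b, (κ ∘ₘ μ) {b} ≠ 0) :
    μ ⊗ₘ κ ≪ μ.prod (κ ∘ₘ μ) := by
  rw [compProd_eq_withDensity_infoDensity μ κ h]
  exact withDensity_absolutelyContinuous _ _

theorem llr_compProd_eq (h : ∀ b, (κ ∘ₘ μ) {b} ≠ 0) :
    llr (μ ⊗ₘ κ) (μ.prod (κ ∘ₘ μ)) =ᵐ[μ ⊗ₘ κ] fun p => Real.log (infoDensity μ κ p).toReal := by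
  filter_upwards [(compProd_absolutelyContinuous_prod μ κ h).ae_le (rnDeriv_compProd_eq μ κ h)]
    with p hp
  rw [llr, hp]

theorem integrable_log_infoDensity (h : ∀ b, (κ ∘ₘ μ) {b} ≠ 0) (hfin : mutualInfo (μ ⊗ₘ κ) ≠ ∞) :
    Integrable (fun p => Real.log (infoDensity μ κ p).toReal) (μ ⊗ₘ κ) := by
  rw [mutualInfo_compProd, klDiv_ne_top_iff] at hfin
  exact hfin.2.congr (llr_compProd_eq μ κ h)

theorem integral_log_infoDensity (h : ∀ b, (κ ∘ₘ μ) {b} ≠ 0) :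
    ∫ p, Real.log (infoDensity μ κ p).toReal ∂(μ ⊗ₘ κ) = (mutualInfo (μ ⊗ₘ κ)).toReal := by
  rw [mutualInfo_compProd, toReal_klDiv_of_measure_eq (compProd_absolutelyContinuous_prod μ κ h)
    (by simp)]
  exact integral_congr_ae (llr_compProd_eq μ κ h).symm

/-- Split `log s = log (w / q) + log (q / p)` and apply `log t ≤ t - 1` to `(w / q) ^ ρ` and to `q /
p`. The negative terms are moved across so that both sides are sums of nonnegative terms and can be
integrated in `ℝ≥0∞` without integrability hypotheses. -/
theorem mul_klFun_add_le {ρ s p q w : ℝ} (hρ : 0 < ρ) (hp : 0 < p) (hq : 0 < q) (hw : 0 < w)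
    (hs : s = w / p) :
    ρ * klFun s + s + 2 * ρ * s ≤ s * (w / q) ^ ρ + ρ * (s * (q / p)) + ρ := by
  have hs0 : 0 < s := hs ▸ div_pos hw hp
  have h1 : Real.log s = Real.log (w / q) + Real.log (q / p) := by
    rw [← Real.log_mul (by positivity) (by positivity), hs]
    congr 1
    field_simp
  have h2 : ρ * Real.log (w / q) ≤ (w / q) ^ ρ - 1 := by
    rw [← Real.log_rpow (by positivity)]
    exact Real.log_le_sub_one_of_pos (by positivity)
  have h3 : Real.log (q / p) ≤ q / p - 1 := Real.log_le_sub_one_of_pos (by positivity)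
  rw [klFun_apply, h1]
  nlinarith [mul_le_mul_of_nonneg_left h2 hs0.le,
    mul_le_mul_of_nonneg_left h3 (mul_pos hρ hs0).le]

/-- A Rényi type upper bound for the mutual information, in terms of an arbitrary reference output
law `q`. -/
theorem ofReal_mul_mutualInfo_add_one_le (hκ : ∀ a b, κ a {b} ≠ 0) {ρ : ℝ} (hρ : 0 < ρ)
    (q : β → ℝ≥0∞) (hq0 : ∀ b, q b ≠ 0) (hq : ∑' b, q b ≤ 1) :
    ENNReal.ofReal ρ * mutualInfo (μ ⊗ₘ κ) + 1 ≤ ∫⁻ p, (κ p.1 {p.2} / q p.2) ^ ρ ∂(μ ⊗ₘ κ) := by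
  have h : ∀ b, (κ ∘ₘ μ) {b} ≠ 0 := by
    intro b hb
    rw [Measure.bind_apply (measurableSet_singleton b) (by fun_prop),
      lintegral_eq_zero_iff (by exact .of_discrete)] at hb
    obtain ⟨a, ha⟩ := hb.exists
    exact hκ a b ha
  have hqt : ∀ b, q b ≠ ∞ := fun b =>
    ne_top_of_le_ne_top ENNReal.one_ne_top ((ENNReal.le_tsum b).trans hq)
  set ν := κ ∘ₘ μ with hν
  have hJ := compProd_eq_withDensity_infoDensity μ κ h
  -- Integrated against the product of the marginals, the left side becomes `ρ I + 1 + 2ρ` and the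
  -- right side at most the Rényi integral plus `2ρ`.
  have key : ∀ p : α × β, ENNReal.ofReal ρ * ENNReal.ofReal (klFun (infoDensity μ κ p).toReal)
      + infoDensity μ κ p + 2 * ENNReal.ofReal ρ * infoDensity μ κ p
      ≤ infoDensity μ κ p * (κ p.1 {p.2} / q p.2) ^ ρ
        + ENNReal.ofReal ρ * (infoDensity μ κ p * (q p.2 / ν {p.2})) + ENNReal.ofReal ρ := by
    rintro ⟨a, b⟩
    have e1 : ν {b} = ENNReal.ofReal (ν {b}).toReal :=
      (ENNReal.ofReal_toReal (measure_ne_top _ _)).symm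
    have e2 : q b = ENNReal.ofReal (q b).toReal := (ENNReal.ofReal_toReal (hqt b)).symm
    have e3 : κ a {b} = ENNReal.ofReal (κ a {b}).toReal :=
      (ENNReal.ofReal_toReal (measure_ne_top _ _)).symm
    have p1 : 0 < (ν {b}).toReal := ENNReal.toReal_pos (h b) (measure_ne_top _ _)
    have p2 : 0 < (q b).toReal := ENNReal.toReal_pos (hq0 b) (hqt b)
    have p3 : 0 < (κ a {b}).toReal := ENNReal.toReal_pos (hκ a b) (measure_ne_top _ _)
    have e4 : infoDensity μ κ (a, b) = ENNReal.ofReal ((κ a {b}).toReal / (ν {b}).toReal) := by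
      rw [infoDensity, ENNReal.ofReal_div_of_pos p1, ← e1, ← e3]
    have p4 : 0 < (κ a {b}).toReal / (ν {b}).toReal := div_pos p3 p1
    have := mul_klFun_add_le hρ p1 p2 p3 rfl
    simp only
    rw [e4, ENNReal.toReal_ofReal p4.le, e1, e2, e3]
    simp only [ENNReal.toReal_ofReal, p1.le, p3.le]
    generalize (ν {b}).toReal = p, (q b).toReal = q', (κ a {b}).toReal = w at *
    have hk := klFun_nonneg p4.le
    rw [← ENNReal.ofReal_div_of_pos p2, ← ENNReal.ofReal_div_of_pos p1,
      ENNReal.ofReal_rpow_of_pos (by positivity), show (2 : ℝ≥0∞) = ENNReal.ofReal 2 by simp]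
    rw [← ENNReal.ofReal_mul (by positivity), ← ENNReal.ofReal_mul (by positivity),
      ← ENNReal.ofReal_mul (by positivity), ← ENNReal.ofReal_mul (by positivity),
      ← ENNReal.ofReal_mul (by positivity), ← ENNReal.ofReal_mul (by positivity),
      ← ENNReal.ofReal_add (by positivity) (by positivity),
      ← ENNReal.ofReal_add (by positivity) (by positivity),
      ← ENNReal.ofReal_add (by positivity) (by positivity),
      ← ENNReal.ofReal_add (by positivity) (by positivity)]
    exact ENNReal.ofReal_le_ofReal this
  have hint := lintegral_mono (μ := μ.prod ν) key
  have md : ∀ f : α × β → ℝ≥0∞, Measurable f := fun f => .of_discrete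
  rw [lintegral_add_right _ (md _), lintegral_add_right _ (md _), lintegral_add_right _ (md _),
    lintegral_add_right _ (md _), lintegral_const_mul _ (md _), lintegral_const_mul _ (md _),
    lintegral_const_mul _ (md _)] at hint
  have i1 : ∫⁻ p, infoDensity μ κ p ∂(μ.prod ν) = 1 := by
    have := measure_univ (μ := μ ⊗ₘ κ)
    rwa [hJ, withDensity_apply _ .univ, setLIntegral_univ] at this
  have i2 : ∫⁻ p, infoDensity μ κ p * (κ p.1 {p.2} / q p.2) ^ ρ ∂(μ.prod ν)
      = ∫⁻ p, (κ p.1 {p.2} / q p.2) ^ ρ ∂(μ ⊗ₘ κ) := by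
    rw [hJ, lintegral_withDensity_eq_lintegral_mul _ (md _) (md _)]
    rfl
  -- The mean of `q / ν` under the output law `ν` is the total mass of `q`.
  have i3 : ∫⁻ p, infoDensity μ κ p * (q p.2 / ν {p.2}) ∂(μ.prod ν) ≤ 1 := by
    have : ∫⁻ p, infoDensity μ κ p * (q p.2 / ν {p.2}) ∂(μ.prod ν)
      = ∫⁻ p, (q p.2 / ν {p.2}) ∂(μ ⊗ₘ κ) := by
      rw [hJ, lintegral_withDensity_eq_lintegral_mul _ (md _) (md _)]
      rfl
    rw [this]
    have h2 : ∫⁻ p, (q p.2 / ν {p.2}) ∂(μ ⊗ₘ κ) = ∫⁻ b, q b / ν {b} ∂ν := by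
      rw [hν, ← Measure.snd_compProd, Measure.snd, lintegral_map (.of_discrete) measurable_snd]
    rw [h2, lintegral_countable']
    refine le_trans (le_of_eq ?_) hq
    exact tsum_congr fun b => ENNReal.div_mul_cancel (h b) (measure_ne_top _ _)
  have i4 : ∫⁻ p, ENNReal.ofReal (klFun (infoDensity μ κ p).toReal) ∂(μ.prod ν)
      = mutualInfo (μ ⊗ₘ κ) := by
    rw [mutualInfo_compProd, klDiv_eq_lintegral_klFun_of_ac
      (compProd_absolutelyContinuous_prod μ κ h)]
    refine lintegral_congr_ae ?_
    filter_upwards [rnDeriv_compProd_eq μ κ h] with p hp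
    rw [hp]
  rw [i1, i2, i4, lintegral_const, measure_univ, mul_one, mul_one] at hint
  have h2 : 2 * ENNReal.ofReal ρ = ENNReal.ofReal ρ + ENNReal.ofReal ρ := two_mul _
  have hint2 : ENNReal.ofReal ρ * mutualInfo (μ ⊗ₘ κ) + 1 + 2 * ENNReal.ofReal ρ
      ≤ ∫⁻ p, (κ p.1 {p.2} / q p.2) ^ ρ ∂(μ ⊗ₘ κ) + 2 * ENNReal.ofReal ρ := by
    refine hint.trans ?_
    rw [h2, add_assoc]
    gcongr
    exact mul_le_of_le_one_right (by simp) i3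
  exact (ENNReal.add_le_add_iff_right (by finiteness)).1 hint2

end Information

/-! ### The uniform message -/

section MessageLaw

variable (M : ℕ)

instance [NeZero M] : IsProbabilityMeasure (Code.messageLaw M) :=
  isProbabilityMeasure_uniformOn Set.finite_univ Set.univ_nonempty

theorem messageLaw_singleton (w : Fin M) : Code.messageLaw M {w} = (M : ℝ≥0∞)⁻¹ := by
  rw [Code.messageLaw, uniformOn_univ]
  simp

theorem lintegral_messageLaw [NeZero M] (f : Fin M → ℝ≥0∞) :
    ∫⁻ w, f w ∂Code.messageLaw M = (M : ℝ≥0∞)⁻¹ * ∑ w, f w := by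
  rw [lintegral_fintype]
  simp_rw [messageLaw_singleton]
  rw [← Finset.sum_mul, mul_comm]

end MessageLaw

/-! ### The converse for a general degraded wiretap channel -/

section Converse

variable {X O Z : Type*} [MeasurableSpace X] [MeasurableSpace O] [MeasurableSpace Z]
  {M : ℕ}

/-- The joint law of message, channel input and channel output. -/
noncomputable def fullLaw (ξ : Kernel (Fin M) X) (K : Kernel X O) : Measure ((Fin M × X) × O) :=
  (Code.messageLaw M ⊗ₘ ξ) ⊗ₘ (K.prodMkLeft (Fin M))

instance [NeZero M] (ξ : Kernel (Fin M) X) [IsMarkovKernel ξ] (K : Kernel X O) [IsMarkovKernel K] :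
    IsProbabilityMeasure (fullLaw ξ K) := by
  rw [fullLaw]; infer_instance

theorem lintegral_fullLaw [NeZero M] (ξ : Kernel (Fin M) X) [IsMarkovKernel ξ] (K : Kernel X O)
    [IsMarkovKernel K] {f : (Fin M × X) × O → ℝ≥0∞} (hf : Measurable f) :
    ∫⁻ p, f p ∂fullLaw ξ K
      = (M : ℝ≥0∞)⁻¹ * ∑ w, ∫⁻ x, ∫⁻ o, f ((w, x), o) ∂K x ∂ξ w := by
  rw [fullLaw, Measure.lintegral_compProd hf, Measure.lintegral_compProd, lintegral_messageLaw]
  · rfl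
  · exact hf.lintegral_kernel_prod_right'

/-- Transfers statements from the full law, on which both receivers live, to the joint law of the
message and what one receiver sees. -/
theorem map_fullLaw [NeZero M] (ξ : Kernel (Fin M) X) [IsMarkovKernel ξ] (K : Kernel X O)
    [IsMarkovKernel K] {ζ : O → Z} (hζ : Measurable ζ) :
    (fullLaw ξ K).map (fun p => (p.1.1, ζ p.2)) = Code.messageLaw M ⊗ₘ (K.map ζ ∘ₖ ξ) := by
  have hm : Measurable fun p : (Fin M × X) × O => (p.1.1, ζ p.2) := by fun_prop
  have := Kernel.IsMarkovKernel.map K hζ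
  refine Measure.ext_of_lintegral _ fun f hf => ?_
  rw [lintegral_map hf hm, lintegral_fullLaw ξ K (f := fun p => f (p.1.1, ζ p.2)) (hf.comp hm), Measure.lintegral_compProd hf,
    lintegral_messageLaw]
  congr 1
  refine Finset.sum_congr rfl fun w _ => ?_
  rw [Kernel.lintegral_comp _ _ _ (by fun_prop)]
  refine lintegral_congr fun x => ?_
  rw [Kernel.lintegral_map _ hζ _ (by fun_prop)]

variable [Countable O] [MeasurableSingletonClass O] [Countable Z] [MeasurableSingletonClass Z]
  [NeZero M]

variable (ξ : Kernel (Fin M) X) [IsMarkovKernel ξ] (K : Kernel X O) [IsMarkovKernel K]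
  (KZ : Kernel X Z) [IsMarkovKernel KZ] (null : Measure O) [IsProbabilityMeasure null]
  (ζ : O → Z) (Θ : X → O → ℝ) (ψ : X → Z → ℝ) (g : O → Fin M)

/-- A change of measure. The factor `ψ / Θ` replaces the density `Θ` of the output by that of its
image under `ζ`; averaging `ψ` over the encoder then produces `κ w {z} / nz {z}`, and the inverse
information density turns `κ w` into the output law `ν`. The remaining integrand depends on `w` only
through the decoder weight, whose sum over messages is at most `2 * M`, and `ν` has mass one. -/
theorem lintegral_tilted_le (hΘ : ∀ x o, 0 < Θ x o) (hψ : ∀ x z, 0 < ψ x z)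
    (hK : ∀ x o, K x {o} = null {o} * ENNReal.ofReal (Θ x o))
    (hKZ : ∀ x z, KZ x {z} = (null.map ζ) {z} * ENNReal.ofReal (ψ x z))
    (hnull : ∀ z, (null.map ζ) {z} ≠ 0)
    (hm : Measurable fun p : (Fin M × X) × O => ψ p.1.2 (ζ p.2) / Θ p.1.2 p.2) :
    ∫⁻ p, (if g p.2 = p.1.1 then (M : ℝ≥0∞) else 1)
        * (infoDensity (Code.messageLaw M) (KZ ∘ₖ ξ) (p.1.1, ζ p.2))⁻¹
        * ENNReal.ofReal (ψ p.1.2 (ζ p.2) / Θ p.1.2 p.2) ∂fullLaw ξ K ≤ 2 := by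
  have hζ : Measurable ζ := .of_discrete
  have : IsProbabilityMeasure (null.map ζ) := Measure.isProbabilityMeasure_map hζ.aemeasurable
  set nz := null.map ζ with hnz
  set κ := KZ ∘ₖ ξ with hκ
  set ν := κ ∘ₘ Code.messageLaw M with hν
  have hKZ0 : ∀ x z, KZ x {z} ≠ 0 := fun x z => by
    rw [hKZ]; exact mul_ne_zero (hnull z) (by simpa using hψ x z)
  have hκz : ∀ w z, κ w {z} = ∫⁻ x, KZ x {z} ∂ξ w := fun w z => by
    rw [hκ, Kernel.comp_apply' _ _ _ (measurableSet_singleton z)]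
  have hκ0 : ∀ w z, κ w {z} ≠ 0 := fun w z h => by
    rw [hκz, lintegral_eq_zero_iff (KZ.measurable_coe (measurableSet_singleton z))] at h
    obtain ⟨x, hx⟩ := h.exists
    exact hKZ0 x z hx
  have hψ' : ∀ x z, ENNReal.ofReal (ψ x z) = KZ x {z} * (nz {z})⁻¹ := fun x z => by
    rw [hKZ, mul_right_comm, ENNReal.mul_inv_cancel (hnull z) (measure_ne_top _ _), one_mul]
  have hmeas1 : Measurable fun p : (Fin M × X) × O =>
      (if g p.2 = p.1.1 then (M : ℝ≥0∞) else 1)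
        * (infoDensity (Code.messageLaw M) κ (p.1.1, ζ p.2))⁻¹ :=
    (Measurable.of_discrete (f := fun q : Fin M × O => (if g q.2 = q.1 then (M : ℝ≥0∞) else 1)
        * (infoDensity (Code.messageLaw M) κ (q.1, ζ q.2))⁻¹)).comp
      (g := fun q : Fin M × O => (if g q.2 = q.1 then (M : ℝ≥0∞) else 1)
        * (infoDensity (Code.messageLaw M) κ (q.1, ζ q.2))⁻¹)
      (f := fun p : (Fin M × X) × O => (p.1.1, p.2)) (by fun_prop)
  rw [lintegral_fullLaw ξ K (f := fun p => (if g p.2 = p.1.1 then (M : ℝ≥0∞) else 1)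
    * (infoDensity (Code.messageLaw M) κ (p.1.1, ζ p.2))⁻¹
    * ENNReal.ofReal (ψ p.1.2 (ζ p.2) / Θ p.1.2 p.2)) (hmeas1.mul hm.ennreal_ofReal)]
  have inner : ∀ w : Fin M, ∫⁻ x, ∫⁻ o, (if g o = w then (M : ℝ≥0∞) else 1)
        * (infoDensity (Code.messageLaw M) κ (w, ζ o))⁻¹
        * ENNReal.ofReal (ψ x (ζ o) / Θ x o) ∂K x ∂ξ w
      = ∑' o, (null {o} * (nz {ζ o})⁻¹ * ν {ζ o}) * (if g o = w then (M : ℝ≥0∞) else 1) := by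
    intro w
    have e : ∀ x, ∫⁻ o, (if g o = w then (M : ℝ≥0∞) else 1)
        * (infoDensity (Code.messageLaw M) κ (w, ζ o))⁻¹
        * ENNReal.ofReal (ψ x (ζ o) / Θ x o) ∂K x
        = ∑' o, null {o} * (nz {ζ o})⁻¹ * (infoDensity (Code.messageLaw M) κ (w, ζ o))⁻¹
          * (if g o = w then (M : ℝ≥0∞) else 1) * KZ x {ζ o} := by
      intro x
      rw [lintegral_countable']
      refine tsum_congr fun o => ?_
      have : ENNReal.ofReal (ψ x (ζ o) / Θ x o) * K x {o}
          = null {o} * (nz {ζ o})⁻¹ * KZ x {ζ o} := by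
        rw [hK, mul_left_comm, ← ENNReal.ofReal_mul (div_pos (hψ _ _) (hΘ _ _)).le,
          div_mul_cancel₀ _ (hΘ x o).ne', hψ']
        ring
      rw [mul_assoc, this]
      ring
    simp_rw [e]
    have hk : ∀ z, Measurable fun x => KZ x {z} := fun z =>
      KZ.measurable_coe (measurableSet_singleton z)
    rw [lintegral_tsum fun o => ((hk _).const_mul _).aemeasurable]
    refine tsum_congr fun o => ?_
    rw [lintegral_const_mul _ (hk _), ← hκz]
    have : (infoDensity (Code.messageLaw M) κ (w, ζ o))⁻¹ * κ w {ζ o} = ν {ζ o} := by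
      rw [infoDensity, ENNReal.inv_div (.inl (measure_ne_top _ _)) (.inr (hκ0 _ _))]
      exact ENNReal.div_mul_cancel (hκ0 _ _) (measure_ne_top _ _)
    rw [← this]
    ring
  simp_rw [inner]
  rw [← Summable.tsum_finsetSum fun _ _ => ENNReal.summable, ← ENNReal.tsum_mul_left]
  have hM0 : (M : ℝ≥0∞) ≠ 0 := by simp [NeZero.ne M]
  have hsum : ∀ o, (M : ℝ≥0∞)⁻¹ * ∑ w, (null {o} * (nz {ζ o})⁻¹ * ν {ζ o})
      * (if g o = w then (M : ℝ≥0∞) else 1) ≤ 2 * (ν {ζ o} * (nz {ζ o})⁻¹ * null {o}) := by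
    intro o
    rw [← Finset.mul_sum]
    -- Only the decoded message gets weight `M`; the others contribute at most `M` together.
    have : ∑ w, (if g o = w then (M : ℝ≥0∞) else 1) ≤ M * 2 := by
      calc ∑ w, (if g o = w then (M : ℝ≥0∞) else 1)
          ≤ ∑ w, ((if g o = w then (M : ℝ≥0∞) else 0) + 1) := by
            gcongr with w; split_ifs <;> simp
        _ = M * 2 := by rw [Finset.sum_add_distrib]; simp; ring
    calc _ ≤ (M : ℝ≥0∞)⁻¹ * (null {o} * (nz {ζ o})⁻¹ * ν {ζ o} * (M * 2)) := by gcongr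
      _ = (M : ℝ≥0∞)⁻¹ * M * (2 * (ν {ζ o} * (nz {ζ o})⁻¹ * null {o})) := by ring
      _ = _ := by rw [ENNReal.inv_mul_cancel hM0 (by simp), one_mul]
  refine (ENNReal.tsum_le_tsum hsum).trans ?_
  rw [ENNReal.tsum_mul_left, ← lintegral_countable' fun o => ν {ζ o} * (nz {ζ o})⁻¹,
    ← lintegral_map (μ := null) (f := fun z => ν {z} * (nz {z})⁻¹) .of_discrete hζ, ← hnz,
    lintegral_countable']
  have : ∀ z, ν {z} * (nz {z})⁻¹ * nz {z} = ν {z} := fun z => by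
    rw [mul_assoc, ENNReal.inv_mul_cancel (hnull z) (measure_ne_top _ _), mul_one]
  simp_rw [this]
  have h1 : ∑' z, ν {z} = 1 := by
    have := lintegral_countable' (μ := ν) fun _ => 1
    simpa using this.symm
  rw [h1, mul_one]

/-- The converse bound for a wiretap channel: when both the joint output `o` and the eavesdropper's
part `ζ o` of it have densities `Θ x` and `ψ x` with respect to a common null law, the information
of the message carried by the joint output exceeds the leakage by at most the mean of
`log (Θ / ψ)`. -/
theorem measureReal_correct_mul_log_le (hΘ : ∀ x o, 0 < Θ x o) (hψ : ∀ x z, 0 < ψ x z)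
    (hK : ∀ x o, K x {o} = null {o} * ENNReal.ofReal (Θ x o))
    (hKZ : ∀ x z, KZ x {z} = (null.map ζ) {z} * ENNReal.ofReal (ψ x z))
    (hmap : K.map ζ = KZ) (hnull : ∀ z, (null.map ζ) {z} ≠ 0)
    (hτ : Integrable (fun p : (Fin M × X) × O =>
      Real.log (Θ p.1.2 p.2 / ψ p.1.2 (ζ p.2))) (fullLaw ξ K))
    (hm : Measurable fun p : (Fin M × X) × O => ψ p.1.2 (ζ p.2) / Θ p.1.2 p.2)
    (hfin : mutualInfo (Code.messageLaw M ⊗ₘ (KZ ∘ₖ ξ)) ≠ ∞) :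
    (fullLaw ξ K).real {p | g p.2 = p.1.1} * Real.log M
      ≤ Real.log 2 + (mutualInfo (Code.messageLaw M ⊗ₘ (KZ ∘ₖ ξ))).toReal
        + ∫ p, Real.log (Θ p.1.2 p.2 / ψ p.1.2 (ζ p.2)) ∂fullLaw ξ K := by
  have hζ : Measurable ζ := .of_discrete
  have hKZ0 : ∀ x z, KZ x {z} ≠ 0 := fun x z => by
    rw [hKZ]; exact mul_ne_zero (hnull z) (by simpa using hψ x z)
  set κ := KZ ∘ₖ ξ with hκ
  have hκ0 : ∀ w z, κ w {z} ≠ 0 := fun w z h => by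
    rw [hκ, Kernel.comp_apply' _ _ _ (measurableSet_singleton z),
      lintegral_eq_zero_iff (KZ.measurable_coe (measurableSet_singleton z))] at h
    obtain ⟨x, hx⟩ := h.exists
    exact hKZ0 x z hx
  have hν0 : ∀ z, (κ ∘ₘ Code.messageLaw M) {z} ≠ 0 := fun z h => by
    rw [Measure.bind_apply (measurableSet_singleton z) (by fun_prop),
      lintegral_eq_zero_iff (by exact .of_discrete)] at h
    obtain ⟨a, ha⟩ := h.exists
    exact hκ0 a z ha
  have hmapm : Measurable fun p : (Fin M × X) × O => (p.1.1, ζ p.2) := by fun_prop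
  have hlaw := map_fullLaw ξ K hζ
  rw [hmap, ← hκ] at hlaw
  have hint_s : Integrable (fun p : (Fin M × X) × O =>
      Real.log (infoDensity (Code.messageLaw M) κ (p.1.1, ζ p.2)).toReal) (fullLaw ξ K) := by
    have := integrable_log_infoDensity _ κ hν0 hfin
    rw [← hlaw] at this
    exact this.comp_measurable hmapm
  have hs : ∫ p, Real.log (infoDensity (Code.messageLaw M) κ (p.1.1, ζ p.2)).toReal ∂fullLaw ξ K
      = (mutualInfo (Code.messageLaw M ⊗ₘ κ)).toReal := by
    rw [← integral_log_infoDensity _ κ hν0, ← hlaw, integral_map hmapm.aemeasurable]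
    exact Measurable.aestronglyMeasurable .of_discrete
  have hD : MeasurableSet {p : (Fin M × X) × O | g p.2 = p.1.1} :=
    measurableSet_eq_fun ((Measurable.of_discrete (f := g)).comp measurable_snd)
      (measurable_fst.comp measurable_fst)
  set P := fullLaw ξ K with hP
  set D := {p : (Fin M × X) × O | g p.2 = p.1.1} with hDdef
  have hMpos : (0 : ℝ) < M := by exact_mod_cast Nat.pos_of_ne_zero (NeZero.ne M)
  -- The mean of `L` is the quantity to be bounded by `log 2`, and `exp L` is the integrand of
  -- `lintegral_tilted_le`.
  let L : (Fin M × X) × O → ℝ := fun p => D.indicator (fun _ => Real.log M) p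
    - Real.log (infoDensity (Code.messageLaw M) κ (p.1.1, ζ p.2)).toReal
    - Real.log (Θ p.1.2 p.2 / ψ p.1.2 (ζ p.2))
  have hi1 : Integrable (D.indicator fun _ => Real.log M) P := (integrable_const _).indicator hD
  have hLint : Integrable L P := (hi1.sub hint_s).sub hτ
  have hLval : ∫ p, L p ∂P = P.real D * Real.log M
      - (mutualInfo (Code.messageLaw M ⊗ₘ κ)).toReal
      - ∫ p, Real.log (Θ p.1.2 p.2 / ψ p.1.2 (ζ p.2)) ∂P := by
    have e1 := integral_sub (hi1.sub hint_s) hτ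
    have e2 := integral_sub hi1 hint_s
    rw [hs, integral_indicator hD] at e2
    refine e1.trans ?_
    congr 1
    refine e2.trans ?_
    simp
  have hexp : ∀ p, ENNReal.ofReal (Real.exp (L p)) = (if g p.2 = p.1.1 then (M : ℝ≥0∞) else 1)
        * (infoDensity (Code.messageLaw M) κ (p.1.1, ζ p.2))⁻¹
        * ENNReal.ofReal (ψ p.1.2 (ζ p.2) / Θ p.1.2 p.2) := by
    intro p
    have h0 : infoDensity (Code.messageLaw M) κ (p.1.1, ζ p.2) ≠ 0 :=
      (ENNReal.div_pos (hκ0 _ _) (measure_ne_top _ _)).ne'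
    have ht : infoDensity (Code.messageLaw M) κ (p.1.1, ζ p.2) ≠ ∞ :=
      ENNReal.div_ne_top (measure_ne_top _ _) (hν0 _)
    have hpos := ENNReal.toReal_pos h0 ht
    have hq : 0 < Θ p.1.2 p.2 / ψ p.1.2 (ζ p.2) := div_pos (hΘ _ _) (hψ _ _)
    simp only [L]
    rw [Real.exp_sub, Real.exp_sub, Real.exp_log hpos, Real.exp_log hq, div_eq_mul_inv _ (_ / _),
      inv_div, ENNReal.ofReal_mul (by positivity), ENNReal.ofReal_div_of_pos hpos,
      ENNReal.ofReal_toReal ht, div_eq_mul_inv (ENNReal.ofReal _)]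
    congr 2
    by_cases hp : g p.2 = p.1.1
    · rw [Set.indicator_of_mem (by exact hp), Real.exp_log hMpos]; simp [hp]
    · rw [Set.indicator_of_notMem (by exact hp)]; simp [hp]
  have hle : ∫⁻ p, ENNReal.ofReal (Real.exp (L p)) ∂P ≤ 2 := by
    simp_rw [hexp]
    exact lintegral_tilted_le ξ K KZ null ζ Θ ψ g hΘ hψ hK hKZ hnull hm
  have hexpm : AEStronglyMeasurable (fun p => Real.exp (L p)) P :=
    Real.continuous_exp.comp_aestronglyMeasurable hLint.aestronglyMeasurable
  have hexpint : Integrable (fun p => Real.exp (L p)) P := by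
    refine ⟨hexpm, ?_⟩
    rw [hasFiniteIntegral_iff_ofReal (ae_of_all _ fun p => (Real.exp_pos _).le)]
    exact hle.trans_lt (by simp)
  have hexple : ∫ p, Real.exp (L p) ∂P ≤ 2 := by
    rw [integral_eq_lintegral_of_nonneg_ae (ae_of_all _ fun p => (Real.exp_pos _).le) hexpm]
    exact ENNReal.toReal_le_of_le_ofReal (by norm_num) (by simpa using hle)
  -- The tangent to `exp` at `log 2`. Since the mean of `exp L` is at most `2`, integration gives
  -- exactly `log 2`.
  have hpt : ∀ p, L p ≤ Real.exp (L p) / 2 + (Real.log 2 - 1) := fun p => by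
    have := Real.add_one_le_exp (L p - Real.log 2)
    rw [Real.exp_sub, Real.exp_log two_pos] at this
    linarith
  have hfinal : ∫ p, L p ∂P ≤ ∫ p, (Real.exp (L p) / 2 + (Real.log 2 - 1)) ∂P :=
    integral_mono hLint ((hexpint.div_const 2).add (integrable_const _)) hpt
  rw [integral_add (hexpint.div_const 2) (integrable_const _), integral_div] at hfinal
  simp only [integral_const, probReal_univ, one_smul] at hfinal
  linarith

end Converse

/-! ### Poisson laws, the degraded pair channel and likelihood ratios -/

theorem poissonMeasure_singleton_ne_zero {r : ℝ≥0} (hr : 0 < r) (k : ℕ) :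
    poissonMeasure r {k} ≠ 0 := by
  rw [poissonMeasure_singleton]
  simp only [ne_eq, ENNReal.ofReal_eq_zero, not_le]
  positivity

theorem tsum_measure_singleton {β : Type*} [MeasurableSpace β] [Countable β]
    [MeasurableSingletonClass β] (μ : Measure β) [IsProbabilityMeasure μ] : ∑' b, μ {b} = 1 := by
  have := lintegral_countable' (μ := μ) fun _ => 1
  simpa using this.symm

theorem lintegral_natCast_poissonMeasure (r : ℝ≥0) :
    ∫⁻ k, (k : ℝ≥0∞) ∂poissonMeasure r = r := by
  rw [lintegral_countable', tsum_eq_zero_add' ENNReal.summable]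
  have h : ∀ k : ℕ, ((k + 1 : ℕ) : ℝ≥0∞) * poissonMeasure r {k + 1}
      = r * poissonMeasure r {k} := fun k => by
    rw [poissonMeasure_singleton, poissonMeasure_singleton, ← ENNReal.ofReal_natCast,
      ← ENNReal.ofReal_coe_nnreal, ← ENNReal.ofReal_mul (by positivity),
      ← ENNReal.ofReal_mul (by positivity)]
    congr 1
    rw [Nat.factorial_succ]
    push_cast
    field_simp
    ring
  simp_rw [h]
  rw [ENNReal.tsum_mul_left, tsum_measure_singleton]
  simp

/-- Shifting the mean of a Poisson law multiplies its masses by an exponential factor. -/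
theorem poissonMeasure_tilt (α lam Δ x : ℝ≥0) (hlam : 0 < lam) (k : ℕ) :
    poissonMeasure ((α * x + lam) * Δ) {k} = poissonMeasure (lam * Δ) {k}
      * ENNReal.ofReal (Real.exp (-(α * x * Δ)) * (1 + α * x / lam) ^ k) := by
  have hl : (0 : ℝ) < lam := hlam
  rw [poissonMeasure_singleton, poissonMeasure_singleton, ← ENNReal.ofReal_mul (by positivity)]
  congr 1
  push_cast
  have e1 : ((α : ℝ) * x + lam) * Δ = lam * Δ * (1 + α * x / lam) := by field_simp; ring
  have e2 : Real.exp (-((α * x + lam) * Δ : ℝ))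
      = Real.exp (-(lam * Δ : ℝ)) * Real.exp (-(α * x * Δ : ℝ)) := by
    rw [← Real.exp_add]; congr 1; ring
  rw [e2, e1, mul_pow]
  ring

section PiKernel

variable {A B : Type*} [MeasurableSpace A] [MeasurableSpace B] [Countable B]
  [MeasurableSingletonClass B]

/-- Memoryless uses of a kernel with countable output space. -/
noncomputable def piKernel (κ : Kernel A B) [IsMarkovKernel κ] (n : ℕ) :
    Kernel (Fin n → A) (Fin n → B) where
  toFun x := Measure.pi fun i => κ (x i)
  measurable' := by
    refine measurable_of_singletons _ fun k => ?_
    simp_rw [Measure.pi_singleton]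
    exact Finset.measurable_prod _ fun i _ =>
      (κ.measurable_coe (measurableSet_singleton _)).comp (measurable_pi_apply i)

variable (κ : Kernel A B) [IsMarkovKernel κ] (n : ℕ)

theorem piKernel_apply (x : Fin n → A) : piKernel κ n x = Measure.pi fun i => κ (x i) := rfl

instance : IsMarkovKernel (piKernel κ n) :=
  ⟨fun x => inferInstanceAs (IsProbabilityMeasure (Measure.pi fun i => κ (x i)))⟩

end PiKernel

/-- The counts of the legitimate receiver together with the additional dark counts of the
eavesdropper. -/
noncomputable def pairChannel (α lB d Δ : ℝ≥0) : Kernel ℝ≥0 (ℕ × ℕ) :=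
  channel α lB Δ ×ₖ Kernel.const _ (poissonMeasure (d * Δ))

instance (α lB d Δ : ℝ≥0) : IsMarkovKernel (pairChannel α lB d Δ) := by
  rw [pairChannel]; infer_instance

theorem pairChannel_apply (α lB d Δ x : ℝ≥0) :
    pairChannel α lB d Δ x
      = (poissonMeasure ((α * x + lB) * Δ)).prod (poissonMeasure (d * Δ)) := by
  rw [pairChannel, Kernel.prod_apply, Kernel.const_apply]; rfl

theorem channelN_apply (α lam Δ : ℝ≥0) (n : ℕ) (x : Fin n → ℝ≥0) :
    channelN α lam Δ n x = Measure.pi fun i => poissonMeasure ((α * x i + lam) * Δ) := rfl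

section Pair

variable (α lB d Δ : ℝ≥0) (n : ℕ)

theorem map_fst_pairChannel :
    (piKernel (pairChannel α lB d Δ) n).map (fun o i => (o i).1) = channelN α lB Δ n := by
  ext1 x
  rw [Kernel.map_apply _ (by fun_prop), piKernel_apply, channelN_apply]
  simp_rw [pairChannel_apply]
  have := Measure.pi_map_pi (ι := Fin n)
    (μ := fun i => (poissonMeasure ((α * x i + lB) * Δ)).prod (poissonMeasure (d * Δ)))
    (f := fun _ => Prod.fst) (hμ := fun i => by
      rw [Measure.map_fst_prod, measure_univ, one_smul]; infer_instance) (fun i => measurable_fst.aemeasurable)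
  rw [this]
  simp_rw [Measure.map_fst_prod, measure_univ, one_smul]

/-- This is the degradedness: equal gains and a larger dark current amount to adding independent
Poisson counts, by the convolution of Poisson laws. -/
theorem map_add_pairChannel :
    (piKernel (pairChannel α lB d Δ) n).map (fun o i => (o i).1 + (o i).2)
      = channelN α (lB + d) Δ n := by
  ext1 x
  rw [Kernel.map_apply _ (by fun_prop), piKernel_apply, channelN_apply]
  simp_rw [pairChannel_apply]
  have h : ∀ i : Fin n, ((poissonMeasure ((α * x i + lB) * Δ)).prod
      (poissonMeasure (d * Δ))).map (fun p => p.1 + p.2)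
        = poissonMeasure ((α * x i + (lB + d)) * Δ) := fun i => by
    have := poissonMeasure_conv_poissonMeasure ((α * x i + lB) * Δ) (d * Δ)
    rw [Measure.conv] at this
    rw [this]
    congr 1
    ring
  have := Measure.pi_map_pi (ι := Fin n)
    (μ := fun i => (poissonMeasure ((α * x i + lB) * Δ)).prod (poissonMeasure (d * Δ)))
    (f := fun _ p => p.1 + p.2) (hμ := fun i => by
      rw [h]; infer_instance) (fun i => Measurable.aemeasurable (by fun_prop))
  rw [this]
  simp_rw [h]

/-- The likelihood ratio of `n` Poisson counts for the inputs `x` and `0`. -/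
noncomputable def likelihood (α lam Δ : ℝ≥0) {n : ℕ} (x : Fin n → ℝ≥0) (y : Fin n → ℕ) : ℝ :=
  ∏ i, (Real.exp (-(α * x i * Δ)) * (1 + α * x i / lam) ^ y i)

theorem likelihood_pos (lam : ℝ≥0) {n : ℕ} (x : Fin n → ℝ≥0) (y : Fin n → ℕ) :
    0 < likelihood α lam Δ x y :=
  Finset.prod_pos fun i _ => by positivity

theorem measurable_likelihood (lam : ℝ≥0) (n : ℕ) :
    Measurable fun p : (Fin n → ℝ≥0) × (Fin n → ℕ) => likelihood α lam Δ p.1 p.2 := by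
  unfold likelihood
  refine Finset.measurable_prod _ fun i _ => ?_
  refine Measurable.mul (by fun_prop) ?_
  exact Measurable.pow (by fun_prop) (by fun_prop)

theorem channelN_singleton (lam : ℝ≥0) (hlam : 0 < lam) (x : Fin n → ℝ≥0) (y : Fin n → ℕ) :
    channelN α lam Δ n x {y}
      = channelN α lam Δ n 0 {y} * ENNReal.ofReal (likelihood α lam Δ x y) := by
  rw [channelN_apply, channelN_apply, Measure.pi_singleton, Measure.pi_singleton, likelihood,
    ENNReal.ofReal_prod_of_nonneg fun i _ => by positivity, ← Finset.prod_mul_distrib]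
  refine Finset.prod_congr rfl fun i _ => ?_
  rw [poissonMeasure_tilt α lam Δ (x i) hlam]
  simp

theorem piKernel_pairChannel_singleton (hlB : 0 < lB) (x : Fin n → ℝ≥0) (o : Fin n → ℕ × ℕ) :
    piKernel (pairChannel α lB d Δ) n x {o} = piKernel (pairChannel α lB d Δ) n 0 {o}
      * ENNReal.ofReal (likelihood α lB Δ x fun i => (o i).1) := by
  rw [piKernel_apply, piKernel_apply, Measure.pi_singleton, Measure.pi_singleton, likelihood,
    ENNReal.ofReal_prod_of_nonneg fun i _ => by positivity, ← Finset.prod_mul_distrib]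
  refine Finset.prod_congr rfl fun i _ => ?_
  rw [pairChannel_apply, pairChannel_apply, show o i = ((o i).1, (o i).2) from rfl,
    ← Set.singleton_prod_singleton, Measure.prod_prod, Measure.prod_prod,
    poissonMeasure_tilt α lB Δ (x i) hlB]
  simp
  ring

theorem channelN_singleton_ne_zero (lam : ℝ≥0) (hlam : 0 < lam) (hΔ : 0 < Δ) (x : Fin n → ℝ≥0)
    (y : Fin n → ℕ) : channelN α lam Δ n x {y} ≠ 0 := by
  rw [channelN_apply, Measure.pi_singleton]
  exact Finset.prod_ne_zero_iff.2 fun i _ => poissonMeasure_singleton_ne_zero (by positivity) _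

/-- Grouping by the two independent counts, rather than by `y` and `z`, makes both coefficients
nonnegative for `lB ≤ lE`, so that each mean can be computed as a `lintegral`. -/
theorem log_likelihood_div (lE : ℝ≥0) (x : Fin n → ℝ≥0) (o : Fin n → ℕ × ℕ) :
    Real.log (likelihood α lB Δ x (fun i => (o i).1)
        / likelihood α lE Δ x (fun i => (o i).1 + (o i).2))
      = ∑ i, ((Real.log (1 + α * x i / lB) - Real.log (1 + α * x i / lE)) * (o i).1
        - Real.log (1 + α * x i / lE) * (o i).2) := by
  rw [likelihood, likelihood, ← Finset.prod_div_distrib, Real.log_prod fun i _ => by positivity]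
  refine Finset.sum_congr rfl fun i _ => ?_
  rw [Real.log_div (by positivity) (by positivity), Real.log_mul (by positivity) (by positivity),
    Real.log_mul (by positivity) (by positivity), Real.log_pow, Real.log_pow]
  push_cast
  ring

theorem lintegral_piKernel_pairChannel_fst (x : Fin n → ℝ≥0) (i : Fin n) :
    ∫⁻ o, ((o i).1 : ℝ≥0∞) ∂piKernel (pairChannel α lB d Δ) n x = ((α * x i + lB) * Δ : ℝ≥0) := by
  rw [piKernel_apply]
  have := (measurePreserving_eval (fun i => pairChannel α lB d Δ (x i)) i).lintegral_comp
    (f := fun p => (p.1 : ℝ≥0∞)) .of_discrete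
  refine this.trans ?_
  rw [pairChannel_apply, ← lintegral_natCast_poissonMeasure,
    ← lintegral_map (μ := (poissonMeasure ((α * x i + lB) * Δ)).prod (poissonMeasure (d * Δ)))
      (f := fun k : ℕ => (k : ℝ≥0∞)) .of_discrete measurable_fst, Measure.map_fst_prod,
    measure_univ, one_smul]

theorem lintegral_piKernel_pairChannel_snd (x : Fin n → ℝ≥0) (i : Fin n) :
    ∫⁻ o, ((o i).2 : ℝ≥0∞) ∂piKernel (pairChannel α lB d Δ) n x = (d * Δ : ℝ≥0) := by
  rw [piKernel_apply]
  have := (measurePreserving_eval (fun i => pairChannel α lB d Δ (x i)) i).lintegral_comp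
    (f := fun p => (p.2 : ℝ≥0∞)) .of_discrete
  refine this.trans ?_
  rw [pairChannel_apply, ← lintegral_natCast_poissonMeasure,
    ← lintegral_map (μ := (poissonMeasure ((α * x i + lB) * Δ)).prod (poissonMeasure (d * Δ)))
      (f := fun k : ℕ => (k : ℝ≥0∞)) .of_discrete measurable_snd, Measure.map_snd_prod,
    measure_univ, one_smul]

end Pair

/-! ### The converse for the Poisson channel -/

/-- The left side minus the right side is a combination, with weights `u`, `lB` and `lE - lB`, of
the logarithms of `(u + lB) / (u + lE)`, `(u + lB) lE / ((u + lE) lB)` and `lE / (u + lE)`. Using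
`log t ≤ t - 1` on each bounds it by `-u (lE - lB) / (u + lE)`. -/
theorem gain_le {u lB lE : ℝ} (hu : 0 ≤ u) (hB : 0 < lB) (hBE : lB ≤ lE) :
    (Real.log (1 + u / lB) - Real.log (1 + u / lE)) * (u + lB)
      - Real.log (1 + u / lE) * (lE - lB) ≤ u * Real.log (lE / lB) := by
  have hE : 0 < lE := hB.trans_le hBE
  have e1 : 1 + u / lB = (u + lB) / lB := by field_simp; ring
  have e2 : 1 + u / lE = (u + lE) / lE := by field_simp; ring
  have pB : 0 < u + lB := by linarith
  have pE : 0 < u + lE := by linarith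
  have k1 := Real.log_le_sub_one_of_pos (div_pos pB pE)
  have k2 := Real.log_le_sub_one_of_pos (div_pos (mul_pos pB hE) (mul_pos pE hB))
  have k3 := Real.log_le_sub_one_of_pos (div_pos hE pE)
  rw [Real.log_div pB.ne' pE.ne'] at k1
  rw [Real.log_div (mul_pos pB hE).ne' (mul_pos pE hB).ne', Real.log_mul pB.ne' hE.ne',
    Real.log_mul pE.ne' hB.ne'] at k2
  rw [Real.log_div hE.ne' pE.ne'] at k3
  rw [e1, e2, Real.log_div pB.ne' hB.ne', Real.log_div pE.ne' hE.ne', Real.log_div hE.ne' hB.ne']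
  have m1 := mul_le_mul_of_nonneg_left k1 hu
  have m2 := mul_le_mul_of_nonneg_left k2 hB.le
  have m3 := mul_le_mul_of_nonneg_left k3 (sub_nonneg.2 hBE)
  have hsum : u * ((u + lB) / (u + lE) - 1) + lB * ((u + lB) * lE / ((u + lE) * lB) - 1)
      + (lE - lB) * (lE / (u + lE) - 1) = -(u * (lE - lB)) / (u + lE) := by
    field_simp
    ring
  have hneg : -(u * (lE - lB)) / (u + lE) ≤ 0 :=
    div_nonpos_of_nonpos_of_nonneg
      (neg_nonpos.2 (mul_nonneg hu (sub_nonneg.2 hBE))) pE.le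
  nlinarith

section

variable {X O : Type*} [MeasurableSpace X] [MeasurableSpace O] {M : ℕ} [NeZero M]
  (ξ : Kernel (Fin M) X) [IsMarkovKernel ξ] (K : Kernel X O) [IsMarkovKernel K]

theorem lintegral_fullLaw_inputLaw {f : X × O → ℝ≥0∞} (hf : Measurable f) :
    ∫⁻ p, f (p.1.2, p.2) ∂fullLaw ξ K
      = ∫⁻ x, ∫⁻ o, f (x, o) ∂K x ∂(Code.messageLaw M).bind ξ := by
  rw [lintegral_fullLaw ξ K (f := fun p => f (p.1.2, p.2)) (by fun_prop),
    Measure.lintegral_bind (by fun_prop) (hf.lintegral_kernel_prod_right').aemeasurable,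
    lintegral_messageLaw]

variable {c : X → ℝ} (hc : Measurable c) (hc0 : ∀ x, 0 ≤ c x) {N : O → ℕ} (hN : Measurable N)
  {m : X → ℝ≥0} (hm : ∀ x, ∫⁻ o, (N o : ℝ≥0∞) ∂K x = m x)
include hc hc0 hN hm

theorem lintegral_mul_count :
    ∫⁻ p, ENNReal.ofReal (c p.1.2 * N p.2) ∂fullLaw ξ K
      = ∫⁻ x, ENNReal.ofReal (c x * m x) ∂(Code.messageLaw M).bind ξ := by
  rw [lintegral_fullLaw_inputLaw ξ K (f := fun q => ENNReal.ofReal (c q.1 * N q.2)) (by fun_prop)]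
  refine lintegral_congr fun x => ?_
  simp_rw [ENNReal.ofReal_mul (hc0 x), ENNReal.ofReal_natCast, ENNReal.ofReal_coe_nnreal]
  rw [lintegral_const_mul _ (by fun_prop), hm]

theorem integrable_mul_count
    (hi : Integrable (fun x => c x * m x) ((Code.messageLaw M).bind ξ)) :
    Integrable (fun p => c p.1.2 * N p.2) (fullLaw ξ K) := by
  refine ⟨Measurable.aestronglyMeasurable (by fun_prop), ?_⟩
  rw [hasFiniteIntegral_iff_ofReal (ae_of_all _ fun p => mul_nonneg (hc0 _) (Nat.cast_nonneg _)),
    lintegral_mul_count ξ K hc hc0 hN hm]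
  have := hi.2
  rwa [hasFiniteIntegral_iff_ofReal
    (ae_of_all _ fun x => mul_nonneg (hc0 _) NNReal.zero_le_coe)] at this

theorem integral_mul_count (hmm : Measurable m) :
    ∫ p, c p.1.2 * N p.2 ∂fullLaw ξ K
    = ∫ x, c x * m x ∂(Code.messageLaw M).bind ξ := by
  rw [integral_eq_lintegral_of_nonneg_ae
    (ae_of_all _ fun p => mul_nonneg (hc0 _) (Nat.cast_nonneg _))
    (Measurable.aestronglyMeasurable (by fun_prop)), lintegral_mul_count ξ K hc hc0 hN hm,
    integral_eq_lintegral_of_nonneg_ae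
    (ae_of_all _ fun x => mul_nonneg (hc0 _) NNReal.zero_le_coe)
    (Measurable.aestronglyMeasurable (by fun_prop))]

end

section

variable {n M : ℕ} (c : Code n M) (α lB lE Δ E : ℝ≥0)

instance [NeZero M] : IsProbabilityMeasure c.inputLaw := by
  rw [Code.inputLaw]; infer_instance

variable {c E}

theorem integrable_input (hE : c.MeetsAverage E) (i : Fin n) :
    Integrable (fun x => (x i : ℝ)) c.inputLaw := by
  refine ⟨Measurable.aestronglyMeasurable (by fun_prop), ?_⟩
  rw [hasFiniteIntegral_iff_ofReal (ae_of_all _ fun x => NNReal.zero_le_coe)]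
  simp_rw [ENNReal.ofReal_coe_nnreal]
  refine lt_of_le_of_lt ((Finset.single_le_sum (f := fun i => ∫⁻ x, (x i : ℝ≥0∞) ∂c.inputLaw)
    (fun _ _ => by simp) (Finset.mem_univ i)).trans hE) (by finiteness)

theorem sum_integral_input_le [NeZero M] (hE : c.MeetsAverage E) :
    ∑ i, ∫ x, (x i : ℝ) ∂c.inputLaw ≤ n * E := by
  have h : ∀ i, ∫ x, (x i : ℝ) ∂c.inputLaw = (∫⁻ x, (x i : ℝ≥0∞) ∂c.inputLaw).toReal := fun i => by
    rw [integral_eq_lintegral_of_nonneg_ae (ae_of_all _ fun x => NNReal.zero_le_coe)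
      (Measurable.aestronglyMeasurable (by fun_prop))]
    simp_rw [ENNReal.ofReal_coe_nnreal]
  simp_rw [h]
  rw [← ENNReal.toReal_sum fun i _ => ?_]
  · exact ENNReal.toReal_le_of_le_ofReal (by positivity) (by
      rw [ENNReal.ofReal_mul (by positivity)]; simpa [Code.MeetsAverage] using hE)
  · have := (integrable_input hE i).2
    rw [hasFiniteIntegral_iff_ofReal (ae_of_all _ fun x => NNReal.zero_le_coe)] at this
    simp_rw [ENNReal.ofReal_coe_nnreal] at this
    exact this.ne

/-- The finite block length converse for the degraded Poisson wiretap channel. -/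
theorem one_sub_errorProb_mul_log_le [NeZero M] (hα : 0 < α) (hlB : 0 < lB) (hle : lB ≤ lE) (hΔ : 0 < Δ)
    (hE : c.MeetsAverage E) (hfin : c.leakage α lE Δ ≠ ∞) :
    (1 - (c.errorProb α lB Δ).toReal) * Real.log M
      ≤ Real.log 2 + (c.leakage α lE Δ).toReal + n * Δ * (α * E * Real.log (lE / lB)) := by
  -- `d` is the dark current that degrades the legitimate channel to the eavesdropper's.
  obtain ⟨d, rfl⟩ := exists_add_of_le hle
  have hlE : 0 < lB + d := by positivity
  have hlB' : (0 : ℝ) < lB := hlB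
  have hle' : (lB : ℝ) ≤ (lB + d : ℝ≥0) := by exact_mod_cast hle
  have hlE' : (0 : ℝ) < (lB + d : ℝ≥0) := hlE
  set K := piKernel (pairChannel α lB d Δ) n with hK
  set KZ := channelN α (lB + d) Δ n with hKZ
  let ζ : (Fin n → ℕ × ℕ) → Fin n → ℕ := fun o i => (o i).1 + (o i).2
  have hmap : K.map ζ = KZ := map_add_pairChannel α lB d Δ n
  have hmap0 : (K 0).map ζ = KZ 0 := by
    rw [← hmap, Kernel.map_apply _ .of_discrete]
  let Θ : (Fin n → ℝ≥0) → (Fin n → ℕ × ℕ) → ℝ := fun x o => likelihood α lB Δ x fun i => (o i).1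
  let ψ : (Fin n → ℝ≥0) → (Fin n → ℕ) → ℝ := fun x z => likelihood α (lB + d) Δ x z
  have hmsr : Measurable fun p : (Fin M × (Fin n → ℝ≥0)) × (Fin n → ℕ × ℕ) =>
      ψ p.1.2 (ζ p.2) / Θ p.1.2 p.2 := by
    refine Measurable.div ?_ ?_
    · exact (measurable_likelihood α Δ (lB + d) n).comp
        (g := fun p : (Fin n → ℝ≥0) × (Fin n → ℕ) => likelihood α (lB + d) Δ p.1 p.2)
        (f := fun p : (Fin M × (Fin n → ℝ≥0)) × (Fin n → ℕ × ℕ) => (p.1.2, ζ p.2)) (by fun_prop)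
    · exact (measurable_likelihood α Δ lB n).comp
        (g := fun p : (Fin n → ℝ≥0) × (Fin n → ℕ) => likelihood α lB Δ p.1 p.2)
        (f := fun p : (Fin M × (Fin n → ℝ≥0)) × (Fin n → ℕ × ℕ) =>
          (p.1.2, fun i => (p.2 i).1)) (by fun_prop)
  have hτeq : ∀ p : (Fin M × (Fin n → ℝ≥0)) × (Fin n → ℕ × ℕ),
      Real.log (Θ p.1.2 p.2 / ψ p.1.2 (ζ p.2)) = ∑ i,
        ((Real.log (1 + α * p.1.2 i / lB) - Real.log (1 + α * p.1.2 i / (lB + d : ℝ≥0)))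
            * (p.2 i).1
          - Real.log (1 + α * p.1.2 i / (lB + d : ℝ≥0)) * (p.2 i).2) :=
    fun p => log_likelihood_div α lB Δ n (lB + d) p.1.2 p.2
  have c1 : ∀ x : ℝ≥0,
      0 ≤ Real.log (1 + α * x / lB) - Real.log (1 + α * x / (lB + d : ℝ≥0)) := fun x => by
    rw [sub_nonneg]
    gcongr
  have c2 : ∀ x : ℝ≥0, 0 ≤ Real.log (1 + α * x / (lB + d : ℝ≥0)) := fun x =>
    Real.log_nonneg (by simp; positivity)
  -- A bound uniform in the intensity, so that the coefficient times the mean count grows at most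
  -- linearly and is integrable under the average constraint alone.
  have c1' : ∀ x : ℝ≥0, Real.log (1 + α * x / lB) - Real.log (1 + α * x / (lB + d : ℝ≥0))
      ≤ Real.log ((lB + d : ℝ≥0) / lB) := fun x => by
    rw [← Real.log_div (by positivity) (by positivity)]
    apply Real.log_le_log (by positivity)
    rw [div_le_div_iff₀ (by positivity) hlB']
    have : (0 : ℝ) ≤ α * x := by positivity
    generalize ((lB + d : ℝ≥0) : ℝ) = e at *
    field_simp
    nlinarith
  have c2' : ∀ x : ℝ≥0, Real.log (1 + α * x / (lB + d : ℝ≥0)) ≤ α * x / (lB + d : ℝ≥0) :=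
    fun x => by
      have := Real.log_le_sub_one_of_pos (x := 1 + α * x / (lB + d : ℝ≥0)) (by positivity)
      linarith
  have hin : ∀ i, Integrable (fun x : Fin n → ℝ≥0 => (x i : ℝ)) c.inputLaw :=
    fun i => integrable_input hE i
  have hi1 : ∀ i, Integrable (fun x : Fin n → ℝ≥0 =>
      (Real.log (1 + α * x i / lB) - Real.log (1 + α * x i / (lB + d : ℝ≥0)))
        * ((α * x i + lB) * Δ : ℝ≥0)) c.inputLaw := fun i => by
    refine Integrable.mono' (g := fun x => Real.log ((lB + d : ℝ≥0) / lB) * ((α * x i + lB) * Δ))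
      (((((hin i).const_mul _).add (integrable_const _)).mul_const _).const_mul _)
      (Measurable.aestronglyMeasurable (by fun_prop)) (ae_of_all _ fun x => ?_)
    rw [Real.norm_of_nonneg (mul_nonneg (c1 _) NNReal.zero_le_coe)]
    push_cast
    exact mul_le_mul_of_nonneg_right (by simpa using c1' (x i)) (by positivity)
  have hi2 : ∀ i, Integrable (fun x : Fin n → ℝ≥0 =>
      Real.log (1 + α * x i / (lB + d : ℝ≥0)) * (d * Δ : ℝ≥0)) c.inputLaw := fun i => by
    refine Integrable.mono' (g := fun x => α * x i / (lB + d : ℝ≥0) * (d * Δ : ℝ≥0))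
      ((((hin i).const_mul _).div_const _).mul_const _)
      (Measurable.aestronglyMeasurable (by fun_prop)) (ae_of_all _ fun x => ?_)
    rw [Real.norm_of_nonneg (mul_nonneg (c2 _) NNReal.zero_le_coe)]
    exact mul_le_mul_of_nonneg_right (c2' (x i)) (by positivity)
  have I1 : ∀ i, _ := fun i => integrable_mul_count c.encoder K
    (c := fun x => Real.log (1 + α * x i / lB) - Real.log (1 + α * x i / (lB + d : ℝ≥0)))
    (by fun_prop) (fun x => c1 (x i)) (N := fun o => (o i).1) (by fun_prop)
    (m := fun x => (α * x i + lB) * Δ) (fun x => lintegral_piKernel_pairChannel_fst α lB d Δ n x i)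
    (hi1 i)
  have J1 : ∀ i, _ := fun i => integral_mul_count c.encoder K
    (c := fun x => Real.log (1 + α * x i / lB) - Real.log (1 + α * x i / (lB + d : ℝ≥0)))
    (by fun_prop) (fun x => c1 (x i)) (N := fun o => (o i).1) (by fun_prop)
    (m := fun x => (α * x i + lB) * Δ) (fun x => lintegral_piKernel_pairChannel_fst α lB d Δ n x i)
    (by fun_prop)
  have I2 : ∀ i, _ := fun i => integrable_mul_count c.encoder K
    (c := fun x => Real.log (1 + α * x i / (lB + d : ℝ≥0)))
    (by fun_prop) (fun x => c2 (x i)) (N := fun o => (o i).2) (by fun_prop)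
    (m := fun x => d * Δ) (fun x => lintegral_piKernel_pairChannel_snd α lB d Δ n x i)
    (hi2 i)
  have J2 : ∀ i, _ := fun i => integral_mul_count c.encoder K
    (c := fun x => Real.log (1 + α * x i / (lB + d : ℝ≥0)))
    (by fun_prop) (fun x => c2 (x i)) (N := fun o => (o i).2) (by fun_prop)
    (m := fun x => d * Δ) (fun x => lintegral_piKernel_pairChannel_snd α lB d Δ n x i)
    (by fun_prop)
  have hτint : Integrable (fun p : (Fin M × (Fin n → ℝ≥0)) × (Fin n → ℕ × ℕ) =>
      Real.log (Θ p.1.2 p.2 / ψ p.1.2 (ζ p.2))) (fullLaw c.encoder K) := by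
    simp_rw [hτeq]
    exact integrable_finsetSum _ fun i _ => (I1 i).sub (I2 i)
  have hτle : ∫ p, Real.log (Θ p.1.2 p.2 / ψ p.1.2 (ζ p.2)) ∂fullLaw c.encoder K
      ≤ n * Δ * (α * E * Real.log ((lB + d : ℝ≥0) / lB)) := by
    simp_rw [hτeq]
    refine (integral_finsetSum _ fun i _ => (I1 i).sub (I2 i)).trans_le ?_
    have hlog : 0 ≤ Real.log ((lB + d : ℝ≥0) / lB) :=
      Real.log_nonneg (by rwa [one_le_div hlB'])
    calc _ ≤ ∑ i, ∫ x, Δ * (α * Real.log ((lB + d : ℝ≥0) / lB)) * (x i : ℝ) ∂c.inputLaw := by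
          refine Finset.sum_le_sum fun i _ => ?_
          refine (integral_sub (I1 i) (I2 i)).trans_le ?_
          rw [J1 i, J2 i]
          refine (integral_sub (hi1 i) (hi2 i)).symm.trans_le ?_
          refine integral_mono ((hi1 i).sub (hi2 i)) ((hin i).const_mul _) fun x => ?_
          have := gain_le (u := α * x i) (by positivity) hlB' hle'
          have h2 := mul_le_mul_of_nonneg_right this (NNReal.zero_le_coe (q := Δ))
          push_cast at h2 ⊢
          linarith
      _ = Δ * (α * Real.log ((lB + d : ℝ≥0) / lB)) * ∑ i, ∫ x, (x i : ℝ) ∂c.inputLaw := by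
          rw [Finset.mul_sum]
          exact Finset.sum_congr rfl fun i _ => integral_const_mul _ _
      _ ≤ Δ * (α * Real.log ((lB + d : ℝ≥0) / lB)) * (n * E) := by
          gcongr
          exact sum_integral_input_le hE
      _ = _ := by ring
  have hleak : c.leakage α (lB + d) Δ = mutualInfo (Code.messageLaw M ⊗ₘ (KZ ∘ₖ c.encoder)) := rfl
  -- The null law is the output law of the zero input, and the decoder ignores the additional dark
  -- counts, so its error probability is that of the code.
  have main := measureReal_correct_mul_log_le c.encoder K KZ (K 0) ζ Θ ψ
    (fun o => c.decoder fun i => (o i).1) (fun x o => likelihood_pos α Δ lB x _)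
    (fun x z => likelihood_pos α Δ (lB + d) x z)
    (fun x o => piKernel_pairChannel_singleton α lB d Δ n hlB x o)
    (fun x z => by rw [hmap0]; exact channelN_singleton α Δ n (lB + d) hlE x z) hmap
    (fun z => by rw [hmap0]; exact channelN_singleton_ne_zero α Δ n (lB + d) hlE hΔ 0 z)
    hτint hmsr (hleak ▸ hfin)
  have herr : (fullLaw c.encoder K).real {p | (c.decoder fun i => (p.2 i).1) = p.1.1}
      = 1 - (c.errorProb α lB Δ).toReal := by
    have hfst : Measurable fun (o : Fin n → ℕ × ℕ) (i : Fin n) => (o i).1 := .of_discrete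
    have h1 := map_fullLaw c.encoder K hfst
    rw [map_fst_pairChannel] at h1
    have h2 : c.errorProb α lB Δ
        = fullLaw c.encoder K {p | (c.decoder fun i => (p.2 i).1) = p.1.1}ᶜ := by
      rw [Code.errorProb, Code.jointLaw, ← h1, Measure.map_apply (by fun_prop) (.of_discrete)]
      rfl
    have hD : MeasurableSet {p : (Fin M × (Fin n → ℝ≥0)) × (Fin n → ℕ × ℕ) |
        (c.decoder fun i => (p.2 i).1) = p.1.1} :=
      measurableSet_eq_fun ((Measurable.of_discrete
        (f := fun o : Fin n → ℕ × ℕ => c.decoder fun i => (o i).1)).comp measurable_snd)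
        (measurable_fst.comp measurable_fst)
    rw [h2, ← measureReal_def, probReal_compl_eq_one_sub hD]
    ring
  rw [herr, ← hleak] at main
  linarith

end

theorem errorProb_le_one {n M : ℕ} [NeZero M] (c : Code n M) (α lam Δ : ℝ≥0) :
    c.errorProb α lam Δ ≤ 1 := by
  have : IsProbabilityMeasure (c.jointLaw α lam Δ) := by
    rw [Code.jointLaw]; infer_instance
  exact prob_le_one

instance (x : ℝ) : NeZero ⌈Real.exp x⌉₊ := ⟨(Nat.ceil_pos.2 (Real.exp_pos x)).ne'⟩

/-- Every secure rate is at most `α E log (lE / lB)`. -/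
theorem IsSecureRate.le {α lB lE Δ E R : ℝ≥0} (hα : 0 < α) (hlB : 0 < lB) (hle : lB ≤ lE)
    (hΔ : 0 < Δ) (hR : IsSecureRate α lB α lE Δ E R) :
    (R : ℝ) ≤ α * E * Real.log (lE / lB) := by
  obtain ⟨c, havg, herr, hleak⟩ := hR
  have hΔ' : (0 : ℝ) < Δ := hΔ
  have herr' : Tendsto (fun n => ((c n).errorProb α lB Δ).toReal) atTop (𝓝 0) := by
    have := (ENNReal.tendsto_toReal (a := 0) (by simp)).comp herr
    rwa [ENNReal.toReal_zero] at this
  have hleak' : Tendsto (fun n : ℕ => ((c n).leakage α lE Δ / n).toReal) atTop (𝓝 0) := by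
    have := (ENNReal.tendsto_toReal (a := 0) (by simp)).comp hleak
    rwa [ENNReal.toReal_zero] at this
  have hn : Tendsto (fun n : ℕ => Real.log 2 / n) atTop (𝓝 0) :=
    tendsto_const_nhds.div_atTop tendsto_natCast_atTop_atTop
  have key : ∀ᶠ n : ℕ in atTop, (1 - ((c n).errorProb α lB Δ).toReal) * (Δ * R)
      ≤ Real.log 2 / n + ((c n).leakage α lE Δ / n).toReal
        + Δ * (α * E * Real.log (lE / lB)) := by
    -- A leakage per slot below one is in particular finite, as the finite block length bound
    -- requires.
    filter_upwards [hleak.eventually (gt_mem_nhds (show (0 : ℝ≥0∞) < 1 by simp)),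
      eventually_gt_atTop 0] with n h1 hn0
    have hn0' : (0 : ℝ) < n := by exact_mod_cast hn0
    have hfin : (c n).leakage α lE Δ ≠ ∞ := fun h => by
      rw [h, ENNReal.top_div_of_ne_top (by simp)] at h1
      simp at h1
    have h2 := one_sub_errorProb_mul_log_le α lB lE Δ hα hlB hle hΔ (havg n) hfin
    have h3 : n * Δ * R ≤ Real.log (⌈Real.exp (n * Δ * R)⌉₊ : ℝ) := by
      rw [Real.le_log_iff_exp_le (by exact_mod_cast Nat.ceil_pos.2 (Real.exp_pos _))]
      exact Nat.le_ceil _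
    have h4 : 0 ≤ 1 - ((c n).errorProb α lB Δ).toReal :=
      sub_nonneg.2 (ENNReal.toReal_le_of_le_ofReal zero_le_one
        (by simpa using errorProb_le_one (c n) α lB Δ))
    have h5 := (mul_le_mul_of_nonneg_left h3 h4).trans h2
    rw [ENNReal.toReal_div, ENNReal.toReal_natCast]
    refine le_of_mul_le_mul_left ?_ hn0'
    have : n * (Real.log 2 / n + ((c n).leakage α lE Δ).toReal / n
        + Δ * (α * E * Real.log (lE / lB))) = Real.log 2 + ((c n).leakage α lE Δ).toReal
        + n * Δ * (α * E * Real.log (lE / lB)) := by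
      field_simp
    rw [this]
    linarith
  have hlim := le_of_tendsto_of_tendsto ((herr'.const_sub 1).mul_const (Δ * R : ℝ))
    ((hn.add hleak').add_const (Δ * (α * E * Real.log (lE / lB)))) key
  simp only [sub_zero, one_mul, add_zero, zero_add] at hlim
  exact le_of_mul_le_mul_left hlim hΔ'

theorem secrecyCapacity_le {α lB lE Δ : ℝ≥0} (hα : 0 < α) (hlB : 0 < lB) (hle : lB ≤ lE)
    (hΔ : 0 < Δ) (E : ℝ≥0) :
    secrecyCapacity α lB α lE Δ E ≤ ENNReal.ofReal (α * Real.log (lE / lB)) * E := by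
  refine iSup₂_le fun R hR => ?_
  have := hR.le hα hlB hle hΔ
  rw [← ENNReal.ofReal_coe_nnreal, ← ENNReal.ofReal_coe_nnreal (p := E),
    ← ENNReal.ofReal_mul' NNReal.zero_le_coe]
  exact ENNReal.ofReal_le_ofReal (by linarith)

/-! ### Jensen's inequality for independent codewords -/

theorem lintegral_rpow_le_rpow_lintegral {Ω : Type*} [MeasurableSpace Ω] (μ : Measure Ω)
    [IsProbabilityMeasure μ] {f : Ω → ℝ≥0∞} (hf : Measurable f) {ρ : ℝ} (hρ : 0 < ρ)
    (hρ1 : ρ ≤ 1) : ∫⁻ ω, f ω ^ ρ ∂μ ≤ (∫⁻ ω, f ω ∂μ) ^ ρ := by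
  have h := eLpNorm'_le_eLpNorm'_of_exponent_le (μ := μ) hρ hρ1 (f := f)
    hf.aestronglyMeasurable
  simp only [eLpNorm', enorm_eq_self, ENNReal.rpow_one, one_div, inv_one] at h
  exact (ENNReal.rpow_inv_le_iff hρ).1 h

section IID

variable {ι 𝒳 : Type*} [Fintype ι] [Fintype 𝒳] [MeasurableSpace 𝒳]
  [MeasurableSingletonClass 𝒳] (q : Measure 𝒳) [IsProbabilityMeasure q]

theorem lintegral_pi_eval (j : ι) (f : 𝒳 → ℝ≥0∞) :
    ∫⁻ C, f (C j) ∂Measure.pi (fun _ : ι => q) = ∫⁻ x, f x ∂q :=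
  (measurePreserving_eval (fun _ : ι => q) j).lintegral_comp (f := f) .of_discrete

/-- The letter `j` is independent of those in `s`, so the integral factors; concavity of `t ^ ρ`
moves the power outside the second factor. It serves both random coding bounds, with `j` the
transmitted codeword. -/
theorem lintegral_mul_rpow_sum_le [DecidableEq ι] {ρ : ℝ} (hρ : 0 < ρ) (hρ1 : ρ ≤ 1)
    (s : Finset ι) {j : ι} (hj : j ∉ s) (h g : 𝒳 → ℝ≥0∞) :
    ∫⁻ C, h (C j) * (∑ i ∈ s, g (C i)) ^ ρ ∂Measure.pi (fun _ : ι => q)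
      ≤ (∫⁻ x, h x ∂q) * (s.card * ∫⁻ x, g x ∂q) ^ ρ := by
  set Q := Measure.pi fun _ : ι => q with hQ
  let X : ι → 𝒳 → ℝ≥0∞ := fun i => if i = j then h else g
  have hind : iIndepFun (fun i (C : ι → 𝒳) => X i (C i)) Q :=
    iIndepFun_pi fun i => Measurable.aemeasurable .of_discrete
  have h1 := hind.indepFun_finsetSum_of_notMem (fun i => .of_discrete) hj
  have h2 := h1.comp (φ := fun t => t ^ ρ) (ψ := id) (by fun_prop) measurable_id
  have e1 : ∀ C : ι → 𝒳, (∑ i ∈ s, fun C : ι → 𝒳 => X i (C i)) C = ∑ i ∈ s, g (C i) := fun C => by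
    rw [Finset.sum_apply]
    refine Finset.sum_congr rfl fun i hi => ?_
    simp only [X]
    rw [if_neg (by rintro rfl; exact hj hi)]
  have h3 := lintegral_mul_eq_lintegral_mul_lintegral_of_indepFun'' (μ := Q)
    (Measurable.aemeasurable .of_discrete) (Measurable.aemeasurable .of_discrete) h2
  simp only [Function.comp_apply, e1, id_eq, X, if_true] at h3
  simp_rw [mul_comm (h _)]
  rw [h3, mul_comm, lintegral_pi_eval q j h]
  gcongr
  refine (lintegral_rpow_le_rpow_lintegral Q .of_discrete hρ hρ1).trans (le_of_eq ?_)
  rw [lintegral_finsetSum _ fun i _ => .of_discrete]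
  simp_rw [hQ, lintegral_pi_eval q _ g]
  simp

end IID

/-! ### Random coding: error probability, leakage and cost -/

section RandomCoding

theorem lintegral_inv_mul_sum {M L : ℕ} {𝒳 : Type*} [Fintype 𝒳] [MeasurableSpace 𝒳]
    [MeasurableSingletonClass 𝒳] (q : Measure 𝒳) (f : Fin M → Fin L → (Fin M × Fin L → 𝒳) → ℝ≥0∞) :
    ∫⁻ C, (M : ℝ≥0∞)⁻¹ * ∑ w, (L : ℝ≥0∞)⁻¹ * ∑ l, f w l C
        ∂Measure.pi (fun _ : Fin M × Fin L => q)
      = (M : ℝ≥0∞)⁻¹ * ∑ w, (L : ℝ≥0∞)⁻¹ * ∑ l,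
        ∫⁻ C, f w l C ∂Measure.pi (fun _ : Fin M × Fin L => q) := by
  rw [lintegral_const_mul _ .of_discrete, lintegral_finsetSum _ fun w _ => .of_discrete]
  congr 1
  refine Finset.sum_congr rfl fun w _ => ?_
  rw [lintegral_const_mul _ .of_discrete, lintegral_finsetSum _ fun w _ => .of_discrete]

variable {n M L : ℕ} [NeZero L] {𝒳 : Type*}

/-- The code that sends the message `w` to a codeword with uniformly chosen second index. -/
noncomputable def codebookCode (φ : 𝒳 → Fin n → ℝ≥0) (C : Fin M × Fin L → 𝒳)
    (dec : (Fin n → ℕ) → Fin M) : Code n M where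
  encoder :=
    { toFun := fun w => (Code.messageLaw L).map fun l => φ (C (w, l))
      measurable' := .of_discrete }
  isMarkovKernel := ⟨fun _ => Measure.isProbabilityMeasure_map (Measurable.aemeasurable .of_discrete)⟩
  decoder := dec

variable (φ : 𝒳 → Fin n → ℝ≥0) (C : Fin M × Fin L → 𝒳) (dec : (Fin n → ℕ) → Fin M)

theorem lintegral_encoder_codebookCode (w : Fin M) {f : (Fin n → ℝ≥0) → ℝ≥0∞}
    (hf : Measurable f) :
    ∫⁻ x, f x ∂(codebookCode φ C dec).encoder w
      = (L : ℝ≥0∞)⁻¹ * ∑ l, f (φ (C (w, l))) := by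
  refine (lintegral_map hf .of_discrete).trans ?_
  rw [lintegral_messageLaw]

theorem lintegral_inputLaw_codebookCode [NeZero M] {f : (Fin n → ℝ≥0) → ℝ≥0∞} (hf : Measurable f) :
    ∫⁻ x, f x ∂(codebookCode φ C dec).inputLaw
      = (M : ℝ≥0∞)⁻¹ * ∑ w, (L : ℝ≥0∞)⁻¹ * ∑ l, f (φ (C (w, l))) := by
  rw [Code.inputLaw, Measure.lintegral_bind (by fun_prop) hf.aemeasurable, lintegral_messageLaw]
  simp_rw [lintegral_encoder_codebookCode φ C dec _ hf]

variable (K : Kernel (Fin n → ℝ≥0) (Fin n → ℕ))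

theorem comp_codebookCode_singleton (w : Fin M) (y : Fin n → ℕ) :
    (K ∘ₖ (codebookCode φ C dec).encoder) w {y}
      = (L : ℝ≥0∞)⁻¹ * ∑ l, K (φ (C (w, l))) {y} := by
  rw [Kernel.comp_apply' _ _ _ (measurableSet_singleton y), lintegral_encoder_codebookCode]
  exact K.measurable_coe (measurableSet_singleton y)

variable [IsMarkovKernel K] [NeZero M]

theorem lintegral_joint_codebookCode (f : Fin M × (Fin n → ℕ) → ℝ≥0∞) :
    ∫⁻ p, f p ∂(Code.messageLaw M ⊗ₘ (K ∘ₖ (codebookCode φ C dec).encoder))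
      = (M : ℝ≥0∞)⁻¹ * ∑ w, (L : ℝ≥0∞)⁻¹ * ∑ l, ∑' y, K (φ (C (w, l))) {y} * f (w, y) := by
  rw [Measure.lintegral_compProd .of_discrete, lintegral_messageLaw]
  congr 1
  refine Finset.sum_congr rfl fun w _ => ?_
  rw [lintegral_countable', ← Summable.tsum_finsetSum fun _ _ => ENNReal.summable,
    ← ENNReal.tsum_mul_left]
  refine tsum_congr fun y => ?_
  rw [comp_codebookCode_singleton, ← Finset.sum_mul]
  ring

/-- Maximum likelihood decoding of both indices, of which the message is kept. -/
noncomputable def mlDecoder (y : Fin n → ℕ) : Fin M :=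
  (Finite.exists_max fun j : Fin M × Fin L => K (φ (C j)) {y}).choose.1

/-- A wrong message means that some rival pair of indices is at least as likely as the true one. The
sum over rivals is then at least the true likelihood, and the union bound may be raised to the power
`ρ`. -/
theorem one_le_of_mlDecoder_ne (hK : ∀ x y, K x {y} ≠ 0) {ρ : ℝ} (hρ : 0 < ρ)
    (j : Fin M × Fin L) (y : Fin n → ℕ) (hne : mlDecoder φ C K y ≠ j.1) :
    1 ≤ ((∑ i ∈ Finset.univ.erase j, K (φ (C i)) {y}) / K (φ (C j)) {y}) ^ ρ := by
  have hmax := (Finite.exists_max fun j : Fin M × Fin L => K (φ (C j)) {y}).choose_spec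
  set j' := (Finite.exists_max fun j : Fin M × Fin L => K (φ (C j)) {y}).choose with hj'
  have hjj : j' ≠ j := fun h => hne (by rw [mlDecoder, ← hj', h])
  refine ENNReal.one_le_rpow ?_ hρ
  rw [ENNReal.le_div_iff_mul_le (.inl (hK _ _)) (.inl (measure_ne_top _ _)), one_mul]
  exact (hmax j).trans (Finset.single_le_sum (f := fun i => K (φ (C i)) {y})
    (fun _ _ => zero_le) (Finset.mem_erase.2 ⟨hjj, Finset.mem_univ _⟩))

theorem inv_mul_sum_inv_mul_sum_const (t : ℝ≥0∞) :
    (M : ℝ≥0∞)⁻¹ * ∑ _w : Fin M, (L : ℝ≥0∞)⁻¹ * ∑ _l : Fin L, t = t := by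
  have hM : (M : ℝ≥0∞) ≠ 0 := by simp [NeZero.ne M]
  have hL : (L : ℝ≥0∞) ≠ 0 := by simp [NeZero.ne L]
  simp only [Finset.sum_const, Finset.card_univ, Fintype.card_fin, nsmul_eq_mul]
  rw [← mul_assoc, ENNReal.inv_mul_cancel hM (by simp), one_mul, ← mul_assoc,
    ENNReal.inv_mul_cancel hL (by simp), one_mul]

variable [Fintype 𝒳] [MeasurableSpace 𝒳] [MeasurableSingletonClass 𝒳]
  (q : Measure 𝒳) [IsProbabilityMeasure q]

/-- Gallager's random coding bound. -/
theorem lintegral_errorProb_le (α lam Δ : ℝ≥0) (hK : ∀ x y, channelN α lam Δ n x {y} ≠ 0) {ρ : ℝ}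
    (hρ : 0 < ρ) (hρ1 : ρ ≤ 1) :
    ∫⁻ C, (codebookCode φ C (mlDecoder φ C (channelN α lam Δ n))).errorProb α lam Δ
        ∂Measure.pi (fun _ : Fin M × Fin L => q)
      ≤ (M * L : ℝ≥0∞) ^ ρ * ∑' y, ∫⁻ x, channelN α lam Δ n (φ x) {y}
        * ((∫⁻ x', channelN α lam Δ n (φ x') {y} ∂q) / channelN α lam Δ n (φ x) {y}) ^ ρ ∂q := by
  set K := channelN α lam Δ n with hKdef
  set Q := Measure.pi (fun _ : Fin M × Fin L => q) with hQ
  have hpt : ∀ C : Fin M × Fin L → 𝒳,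
      (codebookCode φ C (mlDecoder φ C K)).errorProb α lam Δ
        ≤ (M : ℝ≥0∞)⁻¹ * ∑ w, (L : ℝ≥0∞)⁻¹ * ∑ l, ∑' y, K (φ (C (w, l))) {y}
          * ((∑ i ∈ Finset.univ.erase (w, l), K (φ (C i)) {y}) / K (φ (C (w, l))) {y}) ^ ρ := by
    intro C
    rw [Code.errorProb, Code.jointLaw, ← lintegral_indicator_one .of_discrete,
      lintegral_joint_codebookCode]
    gcongr with w _ l _ y
    by_cases hw : mlDecoder φ C K y = w
    · rw [Set.indicator_of_notMem (by simpa [codebookCode] using hw)]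
      exact zero_le
    · rw [Set.indicator_of_mem (by simpa [codebookCode] using hw)]
      exact one_le_of_mlDecoder_ne φ C K hK hρ (w, l) y hw
  refine (lintegral_mono hpt).trans ?_
  rw [lintegral_inv_mul_sum]
  set T := (M * L : ℝ≥0∞) ^ ρ * ∑' y, ∫⁻ x, K (φ x) {y}
        * ((∫⁻ x', K (φ x') {y} ∂q) / K (φ x) {y}) ^ ρ ∂q with hT
  suffices h : ∀ w l, ∫⁻ C, ∑' y, K (φ (C (w, l))) {y}
      * ((∑ i ∈ Finset.univ.erase (w, l), K (φ (C i)) {y}) / K (φ (C (w, l))) {y}) ^ ρ ∂Q ≤ T by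
    rw [← inv_mul_sum_inv_mul_sum_const (M := M) (L := L) T]
    gcongr with w _ l _
    exact h w l
  intro w l
  rw [lintegral_tsum fun y => Measurable.aemeasurable .of_discrete, hT, ← ENNReal.tsum_mul_left]
  refine ENNReal.tsum_le_tsum fun y => ?_
  -- Separates the transmitted codeword from its rivals, which are independent of it.
  have e1 : ∀ C : Fin M × Fin L → 𝒳, K (φ (C (w, l))) {y}
      * ((∑ i ∈ Finset.univ.erase (w, l), K (φ (C i)) {y}) / K (φ (C (w, l))) {y}) ^ ρ
      = K (φ (C (w, l))) {y} * ((K (φ (C (w, l))) {y})⁻¹) ^ ρ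
        * (∑ i ∈ Finset.univ.erase (w, l), K (φ (C i)) {y}) ^ ρ := fun C => by
    rw [div_eq_mul_inv, ENNReal.mul_rpow_of_nonneg _ _ hρ.le]
    ring
  simp_rw [e1]
  refine (lintegral_mul_rpow_sum_le q hρ hρ1 _ (Finset.notMem_erase _ _)
    (fun x => K (φ x) {y} * ((K (φ x) {y})⁻¹) ^ ρ) (fun x => K (φ x) {y})).trans ?_
  have e2 : ∀ x, K (φ x) {y} * ((∫⁻ x', K (φ x') {y} ∂q) / K (φ x) {y}) ^ ρ
      = K (φ x) {y} * ((K (φ x) {y})⁻¹) ^ ρ * (∫⁻ x', K (φ x') {y} ∂q) ^ ρ := fun x => by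
    rw [div_eq_mul_inv, ENNReal.mul_rpow_of_nonneg _ _ hρ.le]
    ring
  simp_rw [e2]
  rw [lintegral_mul_const _ .of_discrete, mul_left_comm, ← ENNReal.mul_rpow_of_nonneg _ _ hρ.le]
  gcongr
  refine (Nat.cast_le.2 (Finset.card_erase_le)).trans ?_
  simp

/-- Average leakage of a random code, by soft covering. -/
theorem lintegral_leakage_le (α lam Δ : ℝ≥0) (hK : ∀ x y, channelN α lam Δ n x {y} ≠ 0) {ρ : ℝ}
    (hρ : 0 < ρ) (hρ1 : ρ ≤ 1) (dec : (Fin M × Fin L → 𝒳) → (Fin n → ℕ) → Fin M) :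
    ∫⁻ C, ENNReal.ofReal ρ * (codebookCode φ C (dec C)).leakage α lam Δ
        ∂Measure.pi (fun _ : Fin M × Fin L => q)
      ≤ ((L : ℝ≥0∞)⁻¹) ^ ρ * ∑' y, ∫⁻ x, channelN α lam Δ n (φ x) {y}
        * (channelN α lam Δ n (φ x) {y} / ∫⁻ x', channelN α lam Δ n (φ x') {y} ∂q) ^ ρ ∂q := by
  set K := channelN α lam Δ n with hKdef
  set Q := Measure.pi (fun _ : Fin M × Fin L => q) with hQ
  set qK : (Fin n → ℕ) → ℝ≥0∞ := fun y => ∫⁻ x', K (φ x') {y} ∂q with hqK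
  set T := ((L : ℝ≥0∞)⁻¹) ^ ρ * ∑' y, ∫⁻ x, K (φ x) {y} * (K (φ x) {y} / qK y) ^ ρ ∂q with hT
  have hqK0 : ∀ y, qK y ≠ 0 := fun y h => by
    rw [hqK, lintegral_eq_zero_iff .of_discrete] at h
    obtain ⟨x, hx⟩ := h.exists
    exact hK _ y hx
  have hqsum : ∑' y, qK y = 1 := by
    rw [hqK, ← lintegral_tsum fun y => Measurable.aemeasurable .of_discrete]
    simp_rw [tsum_measure_singleton]
    simp
  have hqKt : ∀ y, qK y ≠ ∞ := fun y =>
    ne_top_of_le_ne_top ENNReal.one_ne_top ((ENNReal.le_tsum y).trans hqsum.le)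
  have hL0 : (L : ℝ≥0∞) ≠ 0 := by simp [NeZero.ne L]
  have hpt : ∀ C : Fin M × Fin L → 𝒳,
      ENNReal.ofReal ρ * (codebookCode φ C (dec C)).leakage α lam Δ + 1
        ≤ (M : ℝ≥0∞)⁻¹ * ∑ w, (L : ℝ≥0∞)⁻¹ * ∑ l, ∑' y, K (φ (C (w, l))) {y}
          * (((L : ℝ≥0∞)⁻¹ * ∑ l, K (φ (C (w, l))) {y}) / qK y) ^ ρ := by
    intro C
    have hκ : ∀ w y, (K ∘ₖ (codebookCode φ C (dec C)).encoder) w {y} ≠ 0 := fun w y => by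
      rw [comp_codebookCode_singleton]
      refine mul_ne_zero (by simp) fun h => ?_
      exact hK _ y (Finset.sum_eq_zero_iff.1 h 0 (Finset.mem_univ _))
    have := ofReal_mul_mutualInfo_add_one_le (Code.messageLaw M)
      (K ∘ₖ (codebookCode φ C (dec C)).encoder) hκ hρ qK hqK0 hqsum.le
    rw [lintegral_joint_codebookCode] at this
    simp_rw [comp_codebookCode_singleton] at this
    exact this
  have hint := lintegral_mono (μ := Q) hpt
  rw [lintegral_add_right _ measurable_const, lintegral_const, measure_univ, mul_one,
    lintegral_inv_mul_sum] at hint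
  -- By subadditivity of `t ^ ρ`, the transmitted codeword contributes `T`, while the other
  -- codewords of the same message contribute at most `1`, which cancels the `1` of the Rényi bound.
  suffices h : ∀ w l, ∫⁻ C, ∑' y, K (φ (C (w, l))) {y}
      * (((L : ℝ≥0∞)⁻¹ * ∑ l, K (φ (C (w, l))) {y}) / qK y) ^ ρ ∂Q ≤ T + 1 by
    refine (ENNReal.add_le_add_iff_right ENNReal.one_ne_top).1 (hint.trans ?_)
    rw [← inv_mul_sum_inv_mul_sum_const (M := M) (L := L) (T + 1)]
    gcongr with w _ l _
    exact h w l
  intro w l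
  rw [lintegral_tsum fun y => Measurable.aemeasurable .of_discrete, ← hqsum, hT,
    ← ENNReal.tsum_mul_left, ← ENNReal.tsum_add]
  refine ENNReal.tsum_le_tsum fun y => ?_
  -- The other codewords of the message `w`.
  let s : Finset (Fin M × Fin L) :=
    (Finset.univ.erase l).map ⟨fun l' => (w, l'), fun a b h => (Prod.ext_iff.1 h).2⟩
  have hs : (w, l) ∉ s := fun h => by
    obtain ⟨l', hl', he⟩ := Finset.mem_map.1 h
    exact Finset.ne_of_mem_erase hl' (Prod.ext_iff.1 he).2
  have hcard : (s.card : ℝ≥0∞) ≤ L := by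
    rw [Finset.card_map]
    refine (Nat.cast_le.2 (Finset.card_erase_le)).trans ?_
    simp
  have e1 : ∀ C : Fin M × Fin L → 𝒳, K (φ (C (w, l))) {y}
      * (((L : ℝ≥0∞)⁻¹ * ∑ l, K (φ (C (w, l))) {y}) / qK y) ^ ρ
      ≤ ((L : ℝ≥0∞)⁻¹) ^ ρ * (K (φ (C (w, l))) {y} * (K (φ (C (w, l))) {y} / qK y) ^ ρ)
        + ((L : ℝ≥0∞)⁻¹ / qK y) ^ ρ
          * (K (φ (C (w, l))) {y} * (∑ i ∈ s, K (φ (C i)) {y}) ^ ρ) := fun C => by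
    have hsum : ∑ l, K (φ (C (w, l))) {y} = K (φ (C (w, l))) {y} + ∑ i ∈ s, K (φ (C i)) {y} := by
      rw [Finset.sum_map, ← Finset.add_sum_erase _ _ (Finset.mem_univ l)]
      rfl
    rw [hsum, mul_add, ENNReal.add_div]
    refine (mul_le_mul_right (ENNReal.rpow_add_le_add_rpow _ _ hρ.le hρ1) _).trans (le_of_eq ?_)
    rw [mul_div_assoc, ENNReal.mul_rpow_of_nonneg _ _ hρ.le, ENNReal.mul_div_right_comm,
      ENNReal.mul_rpow_of_nonneg _ (∑ i ∈ s, K (φ (C i)) {y}) hρ.le]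
    ring
  refine (lintegral_mono e1).trans ?_
  rw [lintegral_add_left .of_discrete, lintegral_const_mul _ .of_discrete,
    lintegral_const_mul _ .of_discrete,
    lintegral_pi_eval q (w, l) fun x => K (φ x) {y} * (K (φ x) {y} / qK y) ^ ρ]
  gcongr
  calc _ ≤ ((L : ℝ≥0∞)⁻¹ / qK y) ^ ρ * (qK y * (L * qK y) ^ ρ) := by
        gcongr
        refine (lintegral_mul_rpow_sum_le q hρ hρ1 s hs (fun x => K (φ x) {y})
          (fun x => K (φ x) {y})).trans ?_
        gcongr
    _ = qK y * ((L : ℝ≥0∞)⁻¹ / qK y * (L * qK y)) ^ ρ := by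
        rw [ENNReal.mul_rpow_of_nonneg _ (L * qK y) hρ.le]
        ring
    _ = qK y := by
        have : (L : ℝ≥0∞)⁻¹ / qK y * (L * qK y) = 1 := by
          rw [div_eq_mul_inv, mul_mul_mul_comm, ENNReal.inv_mul_cancel hL0 (by simp),
            ENNReal.inv_mul_cancel (hqK0 y) (hqKt y), one_mul]
        rw [this, ENNReal.one_rpow, mul_one]

theorem lintegral_cost_eq (dec : (Fin M × Fin L → 𝒳) → (Fin n → ℕ) → Fin M) :
    ∫⁻ C, ∑ i, ∫⁻ x, (x i : ℝ≥0∞) ∂(codebookCode φ C (dec C)).inputLaw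
        ∂Measure.pi (fun _ : Fin M × Fin L => q)
      = ∑ i, ∫⁻ x, (φ x i : ℝ≥0∞) ∂q := by
  rw [lintegral_finsetSum _ fun i _ => .of_discrete]
  refine Finset.sum_congr rfl fun i _ => ?_
  have : ∀ C : Fin M × Fin L → 𝒳,
      ∫⁻ x, (x i : ℝ≥0∞) ∂(codebookCode φ C (dec C)).inputLaw = (M : ℝ≥0∞)⁻¹ * ∑ w,
        (L : ℝ≥0∞)⁻¹ * ∑ l, (φ (C (w, l)) i : ℝ≥0∞) := fun C =>
    lintegral_inputLaw_codebookCode φ C (dec C) (f := fun x => (x i : ℝ≥0∞)) (by fun_prop)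
  simp_rw [this]
  rw [lintegral_inv_mul_sum]
  simp_rw [lintegral_pi_eval q _ fun x => (φ x i : ℝ≥0∞)]
  exact inv_mul_sum_inv_mul_sum_const _

end RandomCoding

/-! ### Reduction of the random coding bounds to one letter -/

section Tensorization

theorem tsum_pi_prod {β : Type*} : ∀ {n : ℕ} (f : Fin n → β → ℝ≥0∞),
    ∑' y : Fin n → β, ∏ i, f i (y i) = ∏ i, ∑' k, f i k
  | 0, f => by simp [tsum_fintype]
  | n + 1, f => by
    rw [← (Fin.consEquiv fun _ : Fin (n + 1) => β).tsum_eq, ENNReal.tsum_prod',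
      Fin.prod_univ_succ, ← tsum_pi_prod fun i => f i.succ, ← ENNReal.tsum_mul_right]
    refine tsum_congr fun k => ?_
    rw [← ENNReal.tsum_mul_left]
    refine tsum_congr fun y => ?_
    simp [Fin.prod_univ_succ, Fin.consEquiv]

theorem lintegral_pi_prod {β : Type*} [Fintype β] [MeasurableSpace β] [MeasurableSingletonClass β]
    (q : Measure β) [IsProbabilityMeasure q] {n : ℕ} (f : Fin n → β → ℝ≥0∞) :
    ∫⁻ x, ∏ i, f i (x i) ∂Measure.pi (fun _ : Fin n => q) = ∏ i, ∫⁻ b, f i b ∂q := by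
  simp_rw [lintegral_countable']
  rw [← tsum_pi_prod]
  refine tsum_congr fun x => ?_
  rw [Measure.pi_singleton, ← Finset.prod_mul_distrib]

theorem prod_mul_div_rpow {ι : Type*} (s : Finset ι) (a b c : ι → ℝ≥0∞)
    (hc : ∀ i, c i ≠ ∞) {ρ : ℝ} (hρ : 0 ≤ ρ) :
    (∏ i ∈ s, a i) * ((∏ i ∈ s, b i) / ∏ i ∈ s, c i) ^ ρ
      = ∏ i ∈ s, (a i * (b i / c i) ^ ρ) := by
  rw [Finset.prod_mul_distrib, ENNReal.prod_rpow_of_nonneg hρ]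
  congr 2
  simp_rw [div_eq_mul_inv]
  rw [Finset.prod_mul_distrib, ENNReal.prod_inv_distrib]
  exact fun i _ _ _ _ => .inr (hc _)

variable {β γ : Type*} [Fintype β] [MeasurableSpace β] [MeasurableSingletonClass β]
  (q : Measure β) [IsProbabilityMeasure q] (w : β → γ → ℝ≥0∞)
  (hwt : ∀ b k, w b k ≠ ∞) (n : ℕ) {ρ : ℝ} (hρ : 0 ≤ ρ)
include hwt hρ

theorem tsum_lintegral_prod_div_self :
    ∑' y : Fin n → γ, ∫⁻ x, (∏ i, w (x i) (y i))
        * ((∫⁻ x', ∏ i, w (x' i) (y i) ∂Measure.pi (fun _ : Fin n => q))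
          / ∏ i, w (x i) (y i)) ^ ρ ∂Measure.pi (fun _ : Fin n => q)
      = (∑' k, ∫⁻ b, w b k * ((∫⁻ b', w b' k ∂q) / w b k) ^ ρ ∂q) ^ n := by
  have h : ∀ y : Fin n → γ, ∫⁻ x, (∏ i, w (x i) (y i))
        * ((∫⁻ x', ∏ i, w (x' i) (y i) ∂Measure.pi (fun _ : Fin n => q))
          / ∏ i, w (x i) (y i)) ^ ρ ∂Measure.pi (fun _ : Fin n => q)
      = ∏ i, ∫⁻ b, w b (y i) * ((∫⁻ b', w b' (y i) ∂q) / w b (y i)) ^ ρ ∂q := fun y => by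
    rw [← lintegral_pi_prod q fun i b => w b (y i) * ((∫⁻ b', w b' (y i) ∂q) / w b (y i)) ^ ρ]
    refine lintegral_congr fun x => ?_
    rw [lintegral_pi_prod q fun i b => w b (y i)]
    exact prod_mul_div_rpow _ _ _ _ (fun i => hwt _ _) hρ
  simp_rw [h]
  rw [tsum_pi_prod fun _ k => ∫⁻ b, w b k * ((∫⁻ b', w b' k ∂q) / w b k) ^ ρ ∂q]
  simp

theorem tsum_lintegral_prod_self_div :
    ∑' y : Fin n → γ, ∫⁻ x, (∏ i, w (x i) (y i))
        * ((∏ i, w (x i) (y i))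
          / ∫⁻ x', ∏ i, w (x' i) (y i) ∂Measure.pi (fun _ : Fin n => q)) ^ ρ
        ∂Measure.pi (fun _ : Fin n => q)
      = (∑' k, ∫⁻ b, w b k * (w b k / ∫⁻ b', w b' k ∂q) ^ ρ ∂q) ^ n := by
  have hnt : ∀ k, ∫⁻ b, w b k ∂q ≠ ∞ := fun k => by
    rw [lintegral_fintype]
    exact ENNReal.sum_ne_top.2 fun b _ => ENNReal.mul_ne_top (hwt b k) (measure_ne_top _ _)
  have h : ∀ y : Fin n → γ, ∫⁻ x, (∏ i, w (x i) (y i))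
        * ((∏ i, w (x i) (y i))
          / ∫⁻ x', ∏ i, w (x' i) (y i) ∂Measure.pi (fun _ : Fin n => q)) ^ ρ
        ∂Measure.pi (fun _ : Fin n => q)
      = ∏ i, ∫⁻ b, w b (y i) * (w b (y i) / ∫⁻ b', w b' (y i) ∂q) ^ ρ ∂q := fun y => by
    rw [← lintegral_pi_prod q fun i b => w b (y i) * (w b (y i) / ∫⁻ b', w b' (y i) ∂q) ^ ρ]
    refine lintegral_congr fun x => ?_
    rw [lintegral_pi_prod q fun i b => w b (y i)]
    exact prod_mul_div_rpow _ _ _ _ (fun i => hnt _) hρ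
  simp_rw [h]
  rw [tsum_pi_prod fun _ k => ∫⁻ b, w b k * (w b k / ∫⁻ b', w b' k ∂q) ^ ρ ∂q]
  simp

end Tensorization

/-! ### One-letter exponents for the on-off input -/

section SingleLetter

/-- The law of the on-off input: `true` with probability `p`. -/
noncomputable def onOffLaw (p : ℝ≥0) : Measure Bool :=
  (p : ℝ≥0∞) • Measure.dirac true + ((1 - p : ℝ≥0) : ℝ≥0∞) • Measure.dirac false

theorem lintegral_onOffLaw (p : ℝ≥0) (f : Bool → ℝ≥0∞) :
    ∫⁻ b, f b ∂onOffLaw p = p * f true + ((1 - p : ℝ≥0) : ℝ≥0∞) * f false := by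
  rw [onOffLaw, lintegral_add_measure, lintegral_smul_measure, lintegral_smul_measure,
    lintegral_dirac, lintegral_dirac, smul_eq_mul, smul_eq_mul]

theorem isProbabilityMeasure_onOffLaw {p : ℝ≥0} (hp : p ≤ 1) :
    IsProbabilityMeasure (onOffLaw p) := by
  constructor
  rw [← lintegral_one, lintegral_onOffLaw, mul_one, mul_one, ← ENNReal.coe_add,
    add_tsub_cancel_of_le hp, ENNReal.coe_one]

/-- The value of `∑ₖ P_b(k) (P_a(k) / P_b(k)) ^ s` for Poisson laws of means `b` and `a`. -/
noncomputable def chernoffPoisson (b a s : ℝ) : ℝ :=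
  Real.exp (b * ((a / b) ^ s - 1) + s * (b - a))

/-- Tilting a Poisson law gives a Poisson law: each term is the constant `chernoffPoisson b a s`
times a mass of the Poisson law of mean `b (a / b) ^ s`. -/
theorem tsum_poissonMeasure_mul_rpow {a b : ℝ≥0} (ha : 0 < a) (hb : 0 < b) (s : ℝ) :
    ∑' k, poissonMeasure b {k} * (poissonMeasure a {k} / poissonMeasure b {k}) ^ s
      = ENNReal.ofReal (chernoffPoisson b a s) := by
  have ha' : (0 : ℝ) < a := ha
  have hb' : (0 : ℝ) < b := hb
  set c : ℝ≥0 := b * (a / b) ^ s with hc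
  have h : ∀ k, poissonMeasure b {k} * (poissonMeasure a {k} / poissonMeasure b {k}) ^ s
      = ENNReal.ofReal (chernoffPoisson b a s) * poissonMeasure c {k} := fun k => by
    simp_rw [poissonMeasure_singleton]
    rw [← ENNReal.ofReal_div_of_pos (by positivity), ENNReal.ofReal_rpow_of_pos (by positivity),
      ← ENNReal.ofReal_mul (by positivity),
      ← ENNReal.ofReal_mul (by unfold chernoffPoisson; positivity)]
    congr 1
    have e1 : Real.exp (-a) * (a : ℝ) ^ k / (k.factorial : ℝ)
        / (Real.exp (-b) * (b : ℝ) ^ k / (k.factorial : ℝ))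
        = Real.exp (b - a) * ((a / b : ℝ)) ^ k := by
      rw [Real.exp_sub, Real.exp_neg, Real.exp_neg, div_pow]
      field_simp
    have e2 : (Real.exp (b - a) * ((a / b : ℝ)) ^ k) ^ s
        = Real.exp (s * (b - a)) * (((a / b : ℝ)) ^ s) ^ k := by
      rw [Real.mul_rpow (by positivity) (by positivity), ← Real.exp_mul, mul_comm s,
        ← Real.rpow_natCast, ← Real.rpow_natCast, ← Real.rpow_mul (by positivity),
        ← Real.rpow_mul (by positivity), mul_comm s]
    rw [e1, e2, hc, chernoffPoisson]
    push_cast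
    rw [mul_pow]
    have e3 : Real.exp (b * ((a / b : ℝ) ^ s - 1) + s * (b - a))
        = Real.exp (b * (a / b : ℝ) ^ s) * Real.exp (-b) * Real.exp (s * (b - a)) := by
      rw [← Real.exp_add, ← Real.exp_add]; congr 1; ring
    rw [e3, Real.exp_neg (b * (a / b : ℝ) ^ s)]
    field_simp
  simp_rw [h]
  rw [ENNReal.tsum_mul_left, tsum_measure_singleton, mul_one]

/-- The one-letter output masses for the on-off input. -/
noncomputable def onOffMass (a b : ℝ≥0) (x : Bool) (k : ℕ) : ℝ≥0∞ :=
  poissonMeasure (if x then b else a) {k}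

variable {a b p : ℝ≥0} (ha : 0 < a) (hb : 0 < b) {ρ : ℝ} (hρ : 0 < ρ)
include ha hb hρ

/-- For the letter on, the mixture over `P_b` is at most `p + P_a / P_b`, and `t ^ ρ` is
subadditive; for the letter off, Jensen's inequality gives at most `1`. Then `1 + t ≤ exp t`. -/
theorem tsum_onOff_div_self_le (hp : p ≤ 1) (hρ1 : ρ ≤ 1) :
    ∑' k, ∫⁻ x, onOffMass a b x k
        * ((∫⁻ x', onOffMass a b x' k ∂onOffLaw p) / onOffMass a b x k) ^ ρ ∂onOffLaw p
      ≤ ENNReal.ofReal (Real.exp (-(p * (1 - chernoffPoisson b a ρ - (p : ℝ) ^ ρ)))) := by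
  have h0a := fun k => poissonMeasure_singleton_ne_zero ha k
  have h0b := fun k => poissonMeasure_singleton_ne_zero hb k
  have hta : ∀ k, poissonMeasure a {k} ≠ ∞ := fun k => measure_ne_top _ _
  have htb : ∀ k, poissonMeasure b {k} ≠ ∞ := fun k => measure_ne_top _ _
  simp_rw [lintegral_onOffLaw, onOffMass]
  simp only [if_true, Bool.false_eq_true, if_false]
  rw [ENNReal.tsum_add, ENNReal.tsum_mul_left, ENNReal.tsum_mul_left]
  set q : ℕ → ℝ≥0∞ := fun k =>
    (p : ℝ≥0∞) * poissonMeasure b {k} + ((1 - p : ℝ≥0) : ℝ≥0∞) * poissonMeasure a {k} with hq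
  have hqsum : ∑' k, q k = 1 := by
    rw [hq, ENNReal.tsum_add, ENNReal.tsum_mul_left, ENNReal.tsum_mul_left, tsum_measure_singleton,
      tsum_measure_singleton, mul_one, mul_one, ← ENNReal.coe_add, add_tsub_cancel_of_le hp,
      ENNReal.coe_one]
  have hoff : ∑' k, poissonMeasure a {k} * (q k / poissonMeasure a {k}) ^ ρ ≤ 1 := by
    have h1 := lintegral_rpow_le_rpow_lintegral (poissonMeasure a)
      (f := fun k => q k / poissonMeasure a {k}) .of_discrete hρ hρ1
    rw [lintegral_countable', lintegral_countable'] at h1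
    simp_rw [fun k => ENNReal.div_mul_cancel (h0a k) (hta k) (b := q k), hqsum,
      ENNReal.one_rpow, mul_comm (_ ^ ρ)] at h1
    exact h1
  have hon : ∑' k, poissonMeasure b {k} * (q k / poissonMeasure b {k}) ^ ρ
      ≤ (p : ℝ≥0∞) ^ ρ + ENNReal.ofReal (chernoffPoisson b a ρ) := by
    rw [← tsum_poissonMeasure_mul_rpow ha hb]
    have : (p : ℝ≥0∞) ^ ρ = ∑' k, poissonMeasure b {k} * (p : ℝ≥0∞) ^ ρ := by
      rw [ENNReal.tsum_mul_right, tsum_measure_singleton, one_mul]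
    rw [this, ← ENNReal.tsum_add]
    refine ENNReal.tsum_le_tsum fun k => ?_
    rw [← mul_add]
    gcongr
    refine le_trans ?_ (ENNReal.rpow_add_le_add_rpow _ _ hρ.le hρ1)
    gcongr
    rw [hq, ENNReal.add_div, ENNReal.mul_div_cancel_right (h0b k) (htb k)]
    gcongr
    exact mul_le_of_le_one_left (by simp) (by simp)
  refine (add_le_add (mul_le_mul_right hon _) (mul_le_mul_right hoff _)).trans ?_
  have hB : 0 ≤ chernoffPoisson b a ρ := (Real.exp_pos _).le
  have h1p : (((1 - p : ℝ≥0) : ℝ≥0∞)) = ENNReal.ofReal (1 - p) := by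
    rw [← ENNReal.ofReal_coe_nnreal, NNReal.coe_sub hp, NNReal.coe_one]
  have hpp : (p : ℝ≥0∞) = ENNReal.ofReal p := (ENNReal.ofReal_coe_nnreal).symm
  have h1p0 : (0 : ℝ) ≤ 1 - p := sub_nonneg.2 (by exact_mod_cast hp)
  rw [h1p, hpp, ENNReal.ofReal_rpow_of_nonneg (by positivity) hρ.le,
    ← ENNReal.ofReal_add (by positivity) hB, ← ENNReal.ofReal_mul (by positivity), mul_one,
    ← ENNReal.ofReal_add (by positivity) h1p0]
  refine ENNReal.ofReal_le_ofReal ?_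
  refine le_trans (le_of_eq ?_) (Real.add_one_le_exp _)
  ring

/-- The mixture is at least `(1 - p) P_a`, which yields `(1 - p)⁻¹ ^ ρ` times one-letter sums
against `P_a`. The prefactor is the source of the exponent `ρ p / (1 - p)`. -/
theorem tsum_onOff_self_div_le (hp : p < 1) :
    ∑' k, ∫⁻ x, onOffMass a b x k
        * (onOffMass a b x k / ∫⁻ x', onOffMass a b x' k ∂onOffLaw p) ^ ρ ∂onOffLaw p
      ≤ ENNReal.ofReal (Real.exp (ρ * (p / (1 - p)) + p * (chernoffPoisson b a (-ρ) - 1))) := by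
  have h0a := fun k => poissonMeasure_singleton_ne_zero ha k
  have h0b := fun k => poissonMeasure_singleton_ne_zero hb k
  have hta : ∀ k, poissonMeasure a {k} ≠ ∞ := fun k => measure_ne_top _ _
  have htb : ∀ k, poissonMeasure b {k} ≠ ∞ := fun k => measure_ne_top _ _
  have hr0 : ((1 - p : ℝ≥0) : ℝ≥0∞) ≠ 0 := by
    rw [ENNReal.coe_ne_zero]; exact (tsub_pos_of_lt hp).ne'
  simp_rw [lintegral_onOffLaw, onOffMass]
  simp only [if_true, Bool.false_eq_true, if_false]
  rw [ENNReal.tsum_add, ENNReal.tsum_mul_left, ENNReal.tsum_mul_left]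
  set r : ℝ≥0∞ := ((1 - p : ℝ≥0) : ℝ≥0∞) with hr
  have hrt : r ≠ ∞ := by simp [hr]
  set q : ℕ → ℝ≥0∞ := fun k => (p : ℝ≥0∞) * poissonMeasure b {k} + r * poissonMeasure a {k} with hq
  have hdiv : ∀ (t : ℝ≥0∞) k, (t / q k) ^ ρ ≤ (r⁻¹) ^ ρ * (t / poissonMeasure a {k}) ^ ρ :=
    fun t k => by
      rw [← ENNReal.mul_rpow_of_nonneg _ _ hρ.le]
      gcongr
      calc t / q k ≤ t / (r * poissonMeasure a {k}) := by
            gcongr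
            exact le_add_self
        _ = r⁻¹ * (t / poissonMeasure a {k}) := by
            rw [div_eq_mul_inv, ENNReal.mul_inv (.inl hr0) (.inl hrt), div_eq_mul_inv]
            ring
  have hoff : ∑' k, poissonMeasure a {k} * (poissonMeasure a {k} / q k) ^ ρ ≤ (r⁻¹) ^ ρ := by
    calc _ ≤ ∑' k, poissonMeasure a {k} * (r⁻¹) ^ ρ := by
          refine ENNReal.tsum_le_tsum fun k => ?_
          refine mul_le_mul_right ((hdiv _ k).trans (le_of_eq ?_)) _
          rw [ENNReal.div_self (h0a k) (hta k), ENNReal.one_rpow, mul_one]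
      _ = _ := by rw [ENNReal.tsum_mul_right, tsum_measure_singleton, one_mul]
  have hon : ∑' k, poissonMeasure b {k} * (poissonMeasure b {k} / q k) ^ ρ
      ≤ (r⁻¹) ^ ρ * ENNReal.ofReal (chernoffPoisson b a (-ρ)) := by
    rw [← tsum_poissonMeasure_mul_rpow ha hb, ← ENNReal.tsum_mul_left]
    refine ENNReal.tsum_le_tsum fun k => ?_
    rw [mul_left_comm]
    gcongr
    refine (hdiv _ k).trans (le_of_eq ?_)
    rw [ENNReal.rpow_neg, ← ENNReal.inv_rpow, ENNReal.inv_div (.inl (htb k)) (.inl (h0b k))]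
  refine (add_le_add (mul_le_mul_right hon _) (mul_le_mul_right hoff _)).trans ?_
  have hB : 0 ≤ chernoffPoisson b a (-ρ) := (Real.exp_pos _).le
  have h1p0 : (0 : ℝ) < 1 - p := sub_pos.2 (by exact_mod_cast hp)
  have h1p : r = ENNReal.ofReal (1 - p) := by
    rw [hr, ← ENNReal.ofReal_coe_nnreal, NNReal.coe_sub hp.le, NNReal.coe_one]
  have hpp : (p : ℝ≥0∞) = ENNReal.ofReal p := (ENNReal.ofReal_coe_nnreal).symm
  rw [h1p, hpp, ← ENNReal.ofReal_inv_of_pos h1p0,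
    ENNReal.ofReal_rpow_of_nonneg (by positivity) hρ.le,
    ← ENNReal.ofReal_mul (by positivity), ← ENNReal.ofReal_mul (by positivity),
    ← ENNReal.ofReal_mul (by positivity),
    ← ENNReal.ofReal_add (by positivity) (by positivity)]
  refine ENNReal.ofReal_le_ofReal ?_
  have e1 : p * (((1 - p : ℝ)⁻¹) ^ ρ * chernoffPoisson b a (-ρ)) + (1 - p) * ((1 - p : ℝ)⁻¹) ^ ρ
      = ((1 - p : ℝ)⁻¹) ^ ρ * (p * (chernoffPoisson b a (-ρ) - 1) + 1) := by ring
  rw [e1, Real.exp_add]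
  have e2 : ((1 - p : ℝ)⁻¹) ^ ρ ≤ Real.exp (ρ * (p / (1 - p))) := by
    rw [mul_comm ρ, Real.exp_mul]
    refine Real.rpow_le_rpow (by positivity) ?_ hρ.le
    refine le_trans (le_of_eq ?_) (Real.add_one_le_exp _)
    field_simp
    ring
  have e3 := Real.add_one_le_exp (p * (chernoffPoisson b a (-ρ) - 1))
  calc _ ≤ ((1 - p : ℝ)⁻¹) ^ ρ * Real.exp (p * (chernoffPoisson b a (-ρ) - 1)) := by gcongr
    _ ≤ _ := by gcongr

end SingleLetter

/-! ### Random on-off codes and the rates they achieve -/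

section RandomCodes

variable {n : ℕ} (A p : ℝ≥0)

/-- The intensities that an on-off word stands for. -/
noncomputable def onOffWord (x : Fin n → Bool) (i : Fin n) : ℝ≥0 := if x i then A else 0

theorem channelN_onOffWord (α lam Δ : ℝ≥0) (x : Fin n → Bool) (y : Fin n → ℕ) :
    channelN α lam Δ n (onOffWord A x) {y}
      = ∏ i, onOffMass (lam * Δ) ((α * A + lam) * Δ) (x i) (y i) := by
  rw [channelN_apply, Measure.pi_singleton]
  refine Finset.prod_congr rfl fun i _ => ?_
  rw [onOffMass, onOffWord]
  split_ifs <;> simp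

variable {A p} {M L : ℕ} [NeZero M] [NeZero L] {α lam Δ : ℝ≥0} (hlam : 0 < lam) (hΔ : 0 < Δ)
  {ρ : ℝ} (hρ : 0 < ρ) (hρ1 : ρ ≤ 1)

theorem onOffMass_ne_top (a b : ℝ≥0) (x : Bool) (k : ℕ) : onOffMass a b x k ≠ ∞ :=
  measure_ne_top _ _

include hlam hΔ hρ hρ1

theorem lintegral_errorProb_onOff_le (hp : p ≤ 1) :
    ∫⁻ C, (codebookCode (onOffWord A) C
        (mlDecoder (onOffWord A) C (channelN α lam Δ n))).errorProb α lam Δ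
        ∂Measure.pi (fun _ : Fin M × Fin L => Measure.pi fun _ : Fin n => onOffLaw p)
      ≤ (M * L : ℝ≥0∞) ^ ρ * ENNReal.ofReal (Real.exp (-(n * (p * (1 - chernoffPoisson
          ((α * A + lam) * Δ) (lam * Δ) ρ - (p : ℝ) ^ ρ))))) := by
  have := isProbabilityMeasure_onOffLaw hp
  refine (lintegral_errorProb_le (onOffWord A) (Measure.pi fun _ : Fin n => onOffLaw p) α lam Δ
    (channelN_singleton_ne_zero α Δ n lam hlam hΔ) hρ hρ1).trans ?_
  gcongr
  simp_rw [channelN_onOffWord]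
  rw [tsum_lintegral_prod_div_self (onOffLaw p) _ (onOffMass_ne_top _ _) n hρ.le]
  have h := tsum_onOff_div_self_le (a := lam * Δ) (b := (α * A + lam) * Δ) (by positivity)
    (by positivity) hρ hp hρ1
  refine (pow_le_pow_left' h n).trans (le_of_eq ?_)
  rw [← ENNReal.ofReal_pow (Real.exp_pos _).le, ← Real.exp_nat_mul]
  push_cast
  congr 2
  ring

theorem lintegral_leakage_onOff_le (hp : p < 1)
    (dec : (Fin M × Fin L → Fin n → Bool) → (Fin n → ℕ) → Fin M) :
    ∫⁻ C, ENNReal.ofReal ρ * (codebookCode (onOffWord A) C (dec C)).leakage α lam Δ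
        ∂Measure.pi (fun _ : Fin M × Fin L => Measure.pi fun _ : Fin n => onOffLaw p)
      ≤ ((L : ℝ≥0∞)⁻¹) ^ ρ * ENNReal.ofReal (Real.exp (n * (ρ * (p / (1 - p))
          + p * (chernoffPoisson ((α * A + lam) * Δ) (lam * Δ) (-ρ) - 1)))) := by
  have := isProbabilityMeasure_onOffLaw hp.le
  refine (lintegral_leakage_le (onOffWord A) (Measure.pi fun _ : Fin n => onOffLaw p) α lam Δ
    (channelN_singleton_ne_zero α Δ n lam hlam hΔ) hρ hρ1 dec).trans ?_
  gcongr
  simp_rw [channelN_onOffWord]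
  rw [tsum_lintegral_prod_self_div (onOffLaw p) _ (onOffMass_ne_top _ _) n hρ.le]
  have h := tsum_onOff_self_div_le (a := lam * Δ) (b := (α * A + lam) * Δ) (by positivity)
    (by positivity) hρ hp
  refine (pow_le_pow_left' h n).trans (le_of_eq ?_)
  rw [← ENNReal.ofReal_pow (Real.exp_pos _).le, ← Real.exp_nat_mul]
  push_cast
  rfl

omit hlam hΔ hρ hρ1 in
theorem lintegral_cost_onOff (hp : p ≤ 1)
    (dec : (Fin M × Fin L → Fin n → Bool) → (Fin n → ℕ) → Fin M) :
    ∫⁻ C, ∑ i, ∫⁻ x, (x i : ℝ≥0∞) ∂(codebookCode (onOffWord A) C (dec C)).inputLaw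
        ∂Measure.pi (fun _ : Fin M × Fin L => Measure.pi fun _ : Fin n => onOffLaw p)
      = n * (p * A : ℝ≥0) := by
  have := isProbabilityMeasure_onOffLaw hp
  rw [lintegral_cost_eq (onOffWord A) (Measure.pi fun _ : Fin n => onOffLaw p)]
  have h : ∀ i : Fin n, ∫⁻ x, (onOffWord A x i : ℝ≥0∞) ∂Measure.pi (fun _ : Fin n => onOffLaw p)
      = (p * A : ℝ≥0) := fun i => by
    refine (lintegral_pi_eval (onOffLaw p) i fun b => (((if b then A else 0 : ℝ≥0)) : ℝ≥0∞)).trans ?_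
    rw [lintegral_onOffLaw]
    simp
  simp_rw [h]
  simp

end RandomCodes

theorem natCeil_exp_le {x : ℝ} (hx : 0 ≤ x) : (⌈Real.exp x⌉₊ : ℝ) ≤ 2 * Real.exp x := by
  have := Nat.ceil_lt_add_one (Real.exp_pos x).le
  have := Real.one_le_exp hx
  linarith

/-- Random on-off codes achieve the rate `R` when the exponents of the error probability and of the
leakage are both negative. -/
theorem isSecureRate_of_exponents {α lB lE Δ E R RL A p : ℝ≥0} {ρ : ℝ} (hlB : 0 < lB)
    (hlE : 0 < lE) (hΔ : 0 < Δ) (hρ : 0 < ρ) (hρ1 : ρ ≤ 1) (hp : p < 1) (hpE : p * A < E)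
    (hrel : ρ * (Δ * R + RL)
      < p * (1 - chernoffPoisson ((α * A + lB) * Δ) (lB * Δ) ρ - (p : ℝ) ^ ρ))
    (hsec : ρ * (p / (1 - p)) + p * (chernoffPoisson ((α * A + lE) * Δ) (lE * Δ) (-ρ) - 1)
      < ρ * RL) :
    IsSecureRate α lB α lE Δ E R := by
  set x := p * (1 - chernoffPoisson ((α * A + lB) * Δ) (lB * Δ) ρ - (p : ℝ) ^ ρ) with hx
  set y := ρ * (p / (1 - p)) + p * (chernoffPoisson ((α * A + lE) * Δ) (lE * Δ) (-ρ) - 1) with hy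
  set γ₁ := x - ρ * (Δ * R + RL) with hγ₁
  set γ₂ := ρ * RL - y with hγ₂
  have hγ₁0 : 0 < γ₁ := sub_pos.2 hrel
  have hγ₂0 : 0 < γ₂ := sub_pos.2 hsec
  -- Bounds the mean error plus the mean leakage: `4` comes from rounding up the two index counts,
  -- each at most twice the exponential, and `ρ⁻¹` from the factor `ρ` in the leakage bound.
  set δ : ℕ → ℝ := fun n => 4 ^ ρ * Real.exp (-(n * γ₁)) + ρ⁻¹ * Real.exp (-(n * γ₂)) with hδ
  have hδ0 : ∀ n, 0 < δ n := fun n => by positivity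
  have hexp : ∀ γ : ℝ, 0 < γ → Tendsto (fun n : ℕ => Real.exp (-(n * γ))) atTop (𝓝 0) :=
    fun γ hγ => Real.tendsto_exp_atBot.comp (tendsto_neg_atTop_atBot.comp
      (tendsto_natCast_atTop_atTop.atTop_mul_const hγ))
  have hδlim : Tendsto δ atTop (𝓝 0) := by
    simpa using ((hexp γ₁ hγ₁0).const_mul (4 ^ ρ)).add ((hexp γ₂ hγ₂0).const_mul ρ⁻¹)
  -- The slack in the intensity constraint, used to weigh error and leakage against cost.
  set η : ℝ≥0 := E - p * A with hη
  have hη0 : 0 < η := tsub_pos_of_lt hpE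
  have hηE : p * A + η = E := add_tsub_cancel_of_le hpE.le
  have hcode : ∀ n : ℕ, ∃ c : Code n ⌈Real.exp (n * Δ * R)⌉₊, c.MeetsAverage E ∧
      (n : ℝ≥0∞) * ((η / ENNReal.ofReal (δ n)) * (c.errorProb α lB Δ + c.leakage α lE Δ))
        ≤ n * E := by
    intro n
    set M := ⌈Real.exp (n * Δ * R)⌉₊ with hM
    set L := ⌈Real.exp (n * RL)⌉₊ with hL
    have : NeZero M := by rw [hM]; infer_instance
    have : NeZero L := by rw [hL]; infer_instance
    have := isProbabilityMeasure_onOffLaw hp.le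
    set Q := Measure.pi fun _ : Fin M × Fin L => Measure.pi fun _ : Fin n => onOffLaw p with hQ
    let c : (Fin M × Fin L → Fin n → Bool) → Code n M := fun C => codebookCode (onOffWord A) C
      (mlDecoder (onOffWord A) C (channelN α lB Δ n))
    have herr : ∫⁻ C, (c C).errorProb α lB Δ ∂Q
        ≤ ENNReal.ofReal (4 ^ ρ * Real.exp (-(n * γ₁))) := by
      refine (lintegral_errorProb_onOff_le hlB hΔ hρ hρ1 hp.le).trans ?_
      rw [← hx]
      have hML : (M * L : ℝ≥0∞) ≤ ENNReal.ofReal (4 * Real.exp (n * (Δ * R + RL))) := by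
        rw [← ENNReal.ofReal_natCast, ← ENNReal.ofReal_natCast,
          ← ENNReal.ofReal_mul (Nat.cast_nonneg _)]
        refine ENNReal.ofReal_le_ofReal ?_
        have h1 := natCeil_exp_le (x := n * Δ * R) (by positivity)
        have h2 := natCeil_exp_le (x := n * RL) (by positivity)
        calc (M * L : ℝ) ≤ (2 * Real.exp (n * Δ * R)) * (2 * Real.exp (n * RL)) := by gcongr
          _ = 4 * Real.exp (n * (Δ * R + RL)) := by
            rw [mul_mul_mul_comm, ← Real.exp_add]
            norm_num
            ring
      calc _ ≤ (ENNReal.ofReal (4 * Real.exp (n * (Δ * R + RL)))) ^ ρ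
            * ENNReal.ofReal (Real.exp (-(n * x))) := by gcongr
        _ = _ := by
          rw [ENNReal.ofReal_rpow_of_pos (by positivity), ← ENNReal.ofReal_mul (by positivity),
            Real.mul_rpow (by norm_num) (Real.exp_pos _).le, ← Real.exp_mul, mul_assoc,
            ← Real.exp_add, hγ₁]
          congr 3
          ring
    have hleak : ∫⁻ C, (c C).leakage α lE Δ ∂Q
        ≤ ENNReal.ofReal (ρ⁻¹ * Real.exp (-(n * γ₂))) := by
      have h1 : ENNReal.ofReal ρ * ∫⁻ C, (c C).leakage α lE Δ ∂Q
          ≤ ((L : ℝ≥0∞)⁻¹) ^ ρ * ENNReal.ofReal (Real.exp (n * y)) := by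
        rw [← lintegral_const_mul _ .of_discrete]
        exact lintegral_leakage_onOff_le hlE hΔ hρ hρ1 hp fun C =>
          mlDecoder (onOffWord A) C (channelN α lB Δ n)
      have hLle : (L : ℝ≥0∞)⁻¹ ≤ ENNReal.ofReal (Real.exp (-(n * RL))) := by
        rw [Real.exp_neg, ENNReal.ofReal_inv_of_pos (Real.exp_pos _), ENNReal.inv_le_inv,
          ← ENNReal.ofReal_natCast]
        exact ENNReal.ofReal_le_ofReal (Nat.le_ceil _)
      have h2 : ((L : ℝ≥0∞)⁻¹) ^ ρ * ENNReal.ofReal (Real.exp (n * y))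
          ≤ ENNReal.ofReal (Real.exp (-(n * γ₂))) := by
        calc _ ≤ (ENNReal.ofReal (Real.exp (-(n * RL)))) ^ ρ
              * ENNReal.ofReal (Real.exp (n * y)) := by gcongr
          _ = _ := by
            rw [ENNReal.ofReal_rpow_of_pos (by positivity), ← ENNReal.ofReal_mul (by positivity),
              ← Real.exp_mul, ← Real.exp_add, hγ₂]
            congr 2
            ring
      rw [ENNReal.ofReal_mul (by positivity), ENNReal.ofReal_inv_of_pos hρ, mul_comm,
        ← div_eq_mul_inv, ENNReal.le_div_iff_mul_le (.inl (by simpa using hρ)) (.inl (by simp)),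
        mul_comm]
      exact h1.trans h2
    have hsum : ∫⁻ C, ((c C).errorProb α lB Δ + (c C).leakage α lE Δ) ∂Q
        ≤ ENNReal.ofReal (δ n) := by
      rw [lintegral_add_left .of_discrete, hδ, ENNReal.ofReal_add (by positivity) (by positivity)]
      exact add_le_add herr hleak
    -- One functional handles all three demands. Its mean is at most `n p A + n η = n E`, so some
    -- codebook has value at most `n E`; both summands being nonnegative, it meets the cost
    -- constraint exactly and keeps error and leakage within a factor `E / η` of `δ n`. The weight
    -- `n` makes the case `n = 0` harmless.
    obtain ⟨C, hC⟩ := exists_le_lintegral (μ := Q) (f := fun C =>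
      ∑ i, ∫⁻ x, (x i : ℝ≥0∞) ∂(c C).inputLaw + (n : ℝ≥0∞) * ((η / ENNReal.ofReal (δ n))
        * ((c C).errorProb α lB Δ + (c C).leakage α lE Δ))) (Measurable.aemeasurable .of_discrete)
    rw [lintegral_add_left .of_discrete, lintegral_const_mul _ .of_discrete,
      lintegral_const_mul _ .of_discrete, lintegral_cost_onOff hp.le
        fun C => mlDecoder (onOffWord A) C (channelN α lB Δ n)] at hC
    have hδne : ENNReal.ofReal (δ n) ≠ 0 := by simpa using hδ0 n
    have htot : (n : ℝ≥0∞) * (p * A : ℝ≥0) + n * (η / ENNReal.ofReal (δ n)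
        * ∫⁻ C, ((c C).errorProb α lB Δ + (c C).leakage α lE Δ) ∂Q) ≤ n * E := by
      calc _ ≤ (n : ℝ≥0∞) * (p * A : ℝ≥0) + n * (η / ENNReal.ofReal (δ n)
            * ENNReal.ofReal (δ n)) := by gcongr
        _ = n * E := by
          rw [ENNReal.div_mul_cancel hδne (by simp), ← mul_add, ← ENNReal.coe_add, hηE]
    have hC' := hC.trans htot
    exact ⟨c C, le_self_add.trans hC', le_add_self.trans hC'⟩
  choose c hc1 hc2 using hcode
  have hE0 : 0 < E := lt_of_le_of_lt (zero_le) hpE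
  have hbound : ∀ n : ℕ, 0 < n → (c n).errorProb α lB Δ + (c n).leakage α lE Δ
      ≤ E / η * ENNReal.ofReal (δ n) := by
    intro n hn
    have hn0 : (n : ℝ≥0∞) ≠ 0 := by simpa using hn.ne'
    have h1 := (ENNReal.mul_le_mul_iff_right hn0 (by simp)).1 (hc2 n)
    have hδne : ENNReal.ofReal (δ n) ≠ 0 := by simpa using hδ0 n
    have hη' : (η : ℝ≥0∞) ≠ 0 := by simpa using hη0.ne'
    have h2 : (c n).errorProb α lB Δ + (c n).leakage α lE Δ
        = (ENNReal.ofReal (δ n) / η) * ((η / ENNReal.ofReal (δ n))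
          * ((c n).errorProb α lB Δ + (c n).leakage α lE Δ)) := by
      rw [← mul_assoc, ← ENNReal.inv_div (.inl (by simp)) (.inl hδne),
        ENNReal.inv_mul_cancel (ENNReal.div_pos hη' (by simp)).ne'
          (ENNReal.div_ne_top (by simp) hδne), one_mul]
    rw [h2]
    refine (mul_le_mul_right h1 _).trans (le_of_eq ?_)
    rw [div_eq_mul_inv, div_eq_mul_inv]
    ring
  have hlim : Tendsto (fun n => (E / η : ℝ≥0∞) * ENNReal.ofReal (δ n)) atTop (𝓝 0) := by
    have h1 := ENNReal.tendsto_ofReal hδlim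
    rw [ENNReal.ofReal_zero] at h1
    have h2 := ENNReal.Tendsto.const_mul (a := (E / η : ℝ≥0∞)) h1
      (.inr (ENNReal.div_ne_top (by simp) (by simpa using hη0.ne')))
    rwa [mul_zero] at h2
  refine ⟨c, hc1, ?_, ?_⟩
  · refine tendsto_of_tendsto_of_tendsto_of_le_of_le' tendsto_const_nhds hlim
      (Eventually.of_forall fun _ => zero_le) ?_
    filter_upwards [eventually_gt_atTop 0] with n hn
    exact le_self_add.trans (hbound n hn)
  · refine tendsto_of_tendsto_of_tendsto_of_le_of_le' tendsto_const_nhds hlim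
      (Eventually.of_forall fun _ => zero_le) ?_
    filter_upwards [eventually_gt_atTop 0] with n hn
    refine le_trans ?_ (le_add_self.trans (hbound n hn))
    refine ENNReal.div_le_of_le_mul (le_mul_of_one_le_right (zero_le) ?_)
    exact_mod_cast hn

/-! ### Choice of the parameters for small intensity -/

/-- Ensures that the randomization rate chosen in `eventually_isSecureRate` is nonnegative. -/
theorem one_le_chernoffPoisson_neg {a b ρ : ℝ} (ha : 0 < a) (hb : 0 < b) (hρ : 0 < ρ) :
    1 ≤ chernoffPoisson b a (-ρ) := by
  refine Real.one_le_exp ?_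
  have h1 : (a / b) ^ (-ρ) = Real.exp (ρ * Real.log (b / a)) := by
    rw [Real.rpow_def_of_pos (by positivity), ← inv_div, Real.log_inv]
    congr 1
    ring
  have h2 := Real.add_one_le_exp (ρ * Real.log (b / a))
  have h3 := Real.one_sub_inv_le_log_of_pos (div_pos hb ha)
  rw [inv_div] at h3
  rw [h1]
  have h4 : ρ * (1 - a / b) ≤ Real.exp (ρ * Real.log (b / a)) - 1 := by nlinarith
  have h5 := mul_le_mul_of_nonneg_left h4 hb.le
  have h6 : b * (ρ * (1 - a / b)) = ρ * (b - a) := by field_simp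
  linarith

theorem chernoffPoisson_zero (b a : ℝ) : chernoffPoisson b a 0 = 1 := by
  simp [chernoffPoisson]

/-- The derivative is minus the divergence of the Poisson law of mean `b` from that of mean `a`. -/
theorem hasDerivAt_chernoffPoisson {a b : ℝ} (ha : 0 < a) (hb : 0 < b) :
    HasDerivAt (chernoffPoisson b a) (b * Real.log (a / b) + (b - a)) 0 := by
  have h1 : HasDerivAt (fun s : ℝ => (a / b) ^ s) (Real.log (a / b)) 0 := by
    have := (hasDerivAt_id (0 : ℝ)).const_rpow (div_pos ha hb)
    simpa using this
  have h2 : HasDerivAt (fun s : ℝ => b * ((a / b) ^ s - 1) + s * (b - a))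
      (b * Real.log (a / b) + (b - a)) 0 := by
    have := ((h1.sub_const 1).const_mul b).add ((hasDerivAt_id (0 : ℝ)).mul_const (b - a))
    exact this.congr_deriv (by simp)
  exact h2.exp.congr_deriv (by simp)

/-- For large intensities the gain per unit of intensity approaches `log (lE / lB)`. -/
theorem eventually_lt_gain {lB lE Δ t : ℝ} (hlB : 0 < lB) (hlE : 0 < lE) (hΔ : 0 < Δ)
    (ht : t < Real.log (lE / lB)) :
    ∀ᶠ u : ℝ in atTop, 1 + t * u * Δ
      < Δ * ((u + lB) * Real.log (1 + u / lB) - (u + lE) * Real.log (1 + u / lE)) := by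
  have hinv : Tendsto (fun u : ℝ => u⁻¹) atTop (𝓝 0) := tendsto_inv_atTop_zero
  have hdiv : ∀ l : ℝ, 0 < l → Tendsto (fun u : ℝ => Real.log (u⁻¹ + l⁻¹)) atTop
      (𝓝 (Real.log l⁻¹)) := fun l hl => by
    have := (hinv.add_const l⁻¹).log (by simpa using hl.ne')
    simpa using this
  have hlog : Tendsto (fun u : ℝ => Real.log u / u) atTop (𝓝 0) :=
    Real.isLittleO_log_id_atTop.tendsto_div_nhds_zero
  have hlogE : Tendsto (fun u : ℝ => (Real.log u / u + Real.log (u⁻¹ + lE⁻¹) * u⁻¹) * lE) atTop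
      (𝓝 0) := by
    simpa using (hlog.add ((hdiv lE hlE).mul hinv)).mul_const lE
  -- The right side minus `1`, without the nonnegative term `lB * log (1 + u / lB)`, divided by `u *
  -- Δ`. The leading `log u` terms cancel and the remaining one has weight `lE / u`.
  have hall := (((hdiv lB hlB).sub (hdiv lE hlE)).sub hlogE).sub (hinv.mul_const Δ⁻¹)
  have hval : Real.log lB⁻¹ - Real.log lE⁻¹ - 0 - 0 * Δ⁻¹ = Real.log (lE / lB) := by
    rw [Real.log_inv, Real.log_inv, Real.log_div hlE.ne' hlB.ne']
    ring
  rw [hval] at hall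
  filter_upwards [hall.eventually (lt_mem_nhds ht), eventually_gt_atTop 0] with u hu hu0
  have e : ∀ l : ℝ, 0 < l → Real.log (1 + u / l) = Real.log u + Real.log (u⁻¹ + l⁻¹) :=
    fun l hl => by
      rw [← Real.log_mul hu0.ne' (by positivity)]
      congr 1
      field_simp
  have hB : 0 ≤ Real.log (1 + u / lB) := Real.log_nonneg (by simp; positivity)
  have h1 := mul_lt_mul_of_pos_right hu (mul_pos hu0 hΔ)
  have h2 : (Real.log (u⁻¹ + lB⁻¹) - Real.log (u⁻¹ + lE⁻¹)
      - (Real.log u / u + Real.log (u⁻¹ + lE⁻¹) * u⁻¹) * lE - u⁻¹ * Δ⁻¹) * (u * Δ)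
      = Δ * (u * Real.log (1 + u / lB) - (u + lE) * Real.log (1 + u / lE)) - 1 := by
    rw [e lB hlB, e lE hlE]
    field_simp
    ring
  rw [h2] at h1
  have h3 := mul_nonneg hΔ.le (mul_nonneg hlB.le hB)
  nlinarith

/-- Every multiple of the average intensity with a factor below `α log (lE / lB)` is a secure rate
once the average intensity is small. -/
theorem eventually_isSecureRate {α lB lE Δ c : ℝ≥0} (hα : 0 < α) (hlB : 0 < lB) (hlE : 0 < lE)
    (hΔ : 0 < Δ) (hc : (c : ℝ) < α * Real.log (lE / lB)) :
    ∀ᶠ E : ℝ≥0 in 𝓝[>] 0, IsSecureRate α lB α lE Δ E (c * E) := by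
  have hα' : (0 : ℝ) < α := hα
  have hlB' : (0 : ℝ) < lB := hlB
  have hlE' : (0 : ℝ) < lE := hlE
  have hΔ' : (0 : ℝ) < Δ := hΔ
  have hc' : (c : ℝ) / α < Real.log (lE / lB) := by rwa [div_lt_iff₀' hα']
  -- Fixes the pulse height. The extra `1` in the gain will pay for the exponent `ρ p / (1 - p)` of
  -- the leakage bound.
  obtain ⟨u, hu, hu0⟩ := ((eventually_lt_gain hlB' hlE' hΔ' hc').and (eventually_gt_atTop 0)).exists
  obtain ⟨A, hA, rfl⟩ : ∃ A : ℝ≥0, 0 < A ∧ u = α * A := by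
    refine ⟨⟨u / α, by positivity⟩, ?_, ?_⟩
    · exact_mod_cast div_pos hu0 hα'
    · change u = α * (u / α)
      field_simp
  have hA' : (0 : ℝ) < A := hA
  set B := chernoffPoisson ((α * A + lB) * Δ) (lB * Δ) with hBdef
  set K := chernoffPoisson ((α * A + lE) * Δ) (lE * Δ) with hKdef
  have hderiv : HasDerivAt (fun s => -B s - K (-s))
      (Δ * ((α * A + lB) * Real.log (1 + α * A / lB)
        - (α * A + lE) * Real.log (1 + α * A / lE))) 0 := by
    have hB := hasDerivAt_chernoffPoisson (a := lB * Δ) (b := (α * A + lB) * Δ) (by positivity)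
      (by positivity)
    have hK := hasDerivAt_chernoffPoisson (a := lE * Δ) (b := (α * A + lE) * Δ) (by positivity)
      (by positivity)
    rw [← hBdef] at hB
    rw [← hKdef, ← neg_zero] at hK
    have hK2 := hK.comp 0 (hasDerivAt_neg (0 : ℝ))
    have := hB.neg.sub hK2
    refine this.congr_deriv ?_
    have e : ∀ l : ℝ, 0 < l → Real.log (l * Δ / ((α * A + l) * Δ)) = -Real.log (1 + α * A / l) :=
      fun l hl => by
        rw [← Real.log_inv]
        congr 1
        field_simp
        ring
    rw [e lB hlB', e lE hlE']
    ring
  have hslope := hderiv.tendsto_slope_zero_right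
  -- The slope at `0` is the divergence difference, so a small `ρ` loses arbitrarily little of it.
  obtain ⟨ρ, hρlt, hρmem⟩ := ((hslope.eventually (lt_mem_nhds hu)).and
    (Ioc_mem_nhdsGT (zero_lt_one (α := ℝ)))).exists
  obtain ⟨hρ, hρ1⟩ := hρmem
  have hS : ρ * (1 + c * Δ * A) < (1 - B ρ) + (1 - K (-ρ)) := by
    have h0 : B 0 = 1 := chernoffPoisson_zero _ _
    have h0' : K 0 = 1 := chernoffPoisson_zero _ _
    simp only [zero_add, neg_zero, h0, h0', smul_eq_mul] at hρlt
    rw [inv_mul_eq_div, lt_div_iff₀ hρ] at hρlt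
    have e : (c : ℝ) / α * (α * A) = c * A := by field_simp
    rw [e] at hρlt
    linarith
  set gap : ℝ := (1 - B ρ) + (1 - K (-ρ)) - ρ * (1 + c * Δ * A) with hgap
  have hgap0 : 0 < gap := sub_pos.2 hS
  -- With `p = E / (θ A)` the factor `θ > 1` leaves strict slack in the intensity constraint. The
  -- gap is spent as a quarter on `θ`, a half on the smallness of `p`, and a quarter on secrecy.
  obtain ⟨θ, hθ1, hθ⟩ : ∃ θ : ℝ≥0, 1 < θ ∧ ρ * (c * Δ * A) * (θ - 1) ≤ gap / 4 := by
    have hs : 0 < gap / (4 * (ρ * (c * Δ * A) + 1)) := by positivity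
    refine ⟨1 + ⟨gap / (4 * (ρ * (c * Δ * A) + 1)), hs.le⟩, ?_, ?_⟩
    · exact lt_add_of_pos_right _ (by exact_mod_cast hs)
    · change ρ * (c * Δ * A) * (1 + gap / (4 * (ρ * (c * Δ * A) + 1)) - 1) ≤ gap / 4
      rw [add_sub_cancel_left, ← mul_div_assoc, div_le_div_iff₀ (by positivity) (by norm_num)]
      nlinarith
  have hθ0 : 0 < θ := zero_lt_one.trans hθ1
  have hK1 : 1 ≤ K (-ρ) := one_le_chernoffPoisson_neg (by positivity) (by positivity) hρ
  have hcont : ContinuousAt (fun t : ℝ => ρ / (1 - t) + t ^ ρ) 0 := by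
    refine ContinuousAt.add (ContinuousAt.div (by fun_prop) (by fun_prop) (by simp)) ?_
    exact Real.continuousAt_rpow_const _ _ (.inr hρ.le)
  have hsmall : ∀ᶠ t : ℝ in 𝓝 0, t < 1 ∧
      ρ / (1 - t) + t ^ ρ < ρ + gap / 2 := by
    refine (gt_mem_nhds zero_lt_one).and (hcont.eventually (gt_mem_nhds ?_))
    change ρ / (1 - 0) + (0 : ℝ) ^ ρ < ρ + gap / 2
    rw [Real.zero_rpow hρ.ne', sub_zero, div_one]
    linarith
  have htend : Tendsto (fun E : ℝ≥0 => ((E / (θ * A) : ℝ≥0) : ℝ)) (𝓝[>] 0) (𝓝 0) := by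
    have h1 : Continuous fun E : ℝ≥0 => ((E / (θ * A) : ℝ≥0) : ℝ) := by fun_prop
    have h2 := h1.tendsto 0
    simp only [zero_div, NNReal.coe_zero] at h2
    exact h2.mono_left nhdsWithin_le_nhds
  filter_upwards [htend.eventually hsmall, self_mem_nhdsWithin] with E hE hE0
  rw [Set.mem_Ioi] at hE0
  set p : ℝ≥0 := E / (θ * A) with hp
  have hp0 : 0 < p := by positivity
  have hp0' : (0 : ℝ) < p := hp0
  have hEp : E = p * θ * A := by rw [hp]; field_simp
  obtain ⟨hp1, hp2⟩ := hE
  have h1p : (0 : ℝ) < 1 - p := sub_pos.2 hp1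
  -- The randomization rate: just enough to make the leakage exponent negative, by `p * (gap / 4)`.
  have hRL : 0 ≤ (p / (1 - p) + p * (K (-ρ) - 1 + gap / 4) / ρ : ℝ) := by
    have : 0 ≤ K (-ρ) - 1 := sub_nonneg.2 hK1
    positivity
  refine isSecureRate_of_exponents (RL := ⟨_, hRL⟩) (A := A) (p := p) hlB hlE hΔ hρ hρ1
    (by exact_mod_cast hp1) ?_ ?_ ?_
  · rw [hEp, mul_assoc]
    exact mul_lt_mul_of_pos_left (lt_mul_of_one_lt_left hA hθ1) hp0
  · change ρ * (Δ * ((c * E : ℝ≥0) : ℝ) + (p / (1 - p) + p * (K (-ρ) - 1 + gap / 4) / ρ))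
      < p * (1 - B ρ - (p : ℝ) ^ ρ)
    rw [hEp]
    push_cast
    have e : ρ * (Δ * (c * (p * θ * A)) + (p / (1 - p) + p * (K (-ρ) - 1 + gap / 4) / ρ))
        = p * (ρ * (c * Δ * A) * (θ - 1) + ρ * (c * Δ * A) + ρ / (1 - p)
          + (K (-ρ) - 1 + gap / 4) : ℝ) := by
      field_simp
      ring
    rw [e]
    refine mul_lt_mul_of_pos_left ?_ hp0'
    linarith
  · change ρ * (p / (1 - p)) + p * (K (-ρ) - 1)
      < ρ * (p / (1 - p) + p * (K (-ρ) - 1 + gap / 4) / ρ)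
    have e : ρ * (p / (1 - p) + p * (K (-ρ) - 1 + gap / 4) / ρ : ℝ)
        = ρ * (p / (1 - p)) + p * (K (-ρ) - 1) + p * (gap / 4) := by
      field_simp
      ring
    rw [e]
    exact lt_add_of_pos_right _ (by positivity)

end PoissonWiretap

/-- The upper bound holds for every positive `E`; the lower bound holds for each factor `c` below
the limit once `E` is small. Together they give convergence in the order topology. -/
theorem theorem7 (αB lamB αE lamE Δ : ℝ≥0) (hαB : 0 < αB) (hlamB : 0 < lamB) (hlamE : 0 < lamE)
    (hΔ : 0 < Δ) (hα : αB = αE) (hdeg : lamB / αB ≤ lamE / αE) :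
    Tendsto (fun E : ℝ≥0 => PoissonWiretap.secrecyCapacity αB lamB αE lamE Δ E / (E : ℝ≥0∞))
      (𝓝[>] 0) (𝓝 (ENNReal.ofReal (αB * Real.log (lamE / lamB)))) := by
  subst hα
  have hle : lamB ≤ lamE := by
    have := mul_le_mul_of_nonneg_right hdeg hαB.le
    rwa [div_mul_cancel₀ _ hαB.ne', div_mul_cancel₀ _ hαB.ne'] at this
  refine tendsto_order.2 ⟨fun a ha => ?_, fun b hb => ?_⟩
  · obtain ⟨c, hac, hc⟩ := ENNReal.lt_iff_exists_nnreal_btwn.1 ha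
    have hc' : (c : ℝ) < αB * Real.log (lamE / lamB) := by
      rw [← ENNReal.ofReal_coe_nnreal] at hc
      exact (ENNReal.ofReal_lt_ofReal_iff_of_nonneg NNReal.zero_le_coe).1 hc
    filter_upwards [PoissonWiretap.eventually_isSecureRate hαB hlamB hlamE hΔ hc',
      self_mem_nhdsWithin] with E hE hE0
    refine hac.trans_le ?_
    have hE0' : (E : ℝ≥0∞) ≠ 0 := by simpa using (Set.mem_Ioi.1 hE0).ne'
    rw [ENNReal.le_div_iff_mul_le (.inl hE0') (.inl (by simp)), ← ENNReal.coe_mul]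
    exact le_iSup₂ (f := fun (R : ℝ≥0)
      (_ : PoissonWiretap.IsSecureRate αB lamB αB lamE Δ E R) => (R : ℝ≥0∞)) (c * E) hE
  · filter_upwards [self_mem_nhdsWithin] with E hE0
    refine lt_of_le_of_lt ?_ hb
    exact ENNReal.div_le_of_le_mul (PoissonWiretap.secrecyCapacity_le hαB hlamB hle hΔ E)
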